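/- Let $\ell>0$ and let $q\in W^{-1,2}(0,\ell)$ (the dual of $W^{1,2}_0(0,\ell)$, complex-valued). For $y\in W^{1,2}(0,\ell)$ let $\mathbf S_q y\in W^{-1,2}(0,\ell)$ be the distribution $$(\mathbf S_qy\,|\,\phi)=\int_0^\ell y'\phi'\,dx+(q\,|\,y\phi),\qquad \phi\in W^{1,2}_0(0,\ell),$$ and let $\mathscr D_2(\mathbf S_q)$ be the set of all $y\in W^{1,2}(0,\ell)$ for which $\mathbf S_qy$ is an $L^2$-regular distribution (is given by a function in $L^2(0,\ell)$, again denoted $\mathbf S_q y$). Assume that there is $f\in\mathscr D_2(\mathbf S_q)$ with $\mathbf S_qf=0$, $f(x)\ne0$ for all $x\in[0,\ell]$ and $f(0)=1$; write $\mathbf S_f=\mathbf S_q$. For $g\in\{f,\tfrac1f\}$ put $\mathbf D_{g}y=g\,(y/g)'$ for $y\in W^{1,2}(0,\ell)$, and let $\mathbf S_{1/f}=\mathbf S_{q_{1/f}}$, where $$q_{1/f}=f\Bigl(\frac1f\Bigr)'',\qquad (q_{1/f}\,|\,\phi)=\int_0^\ell\Bigl\{\Bigl(\frac{f'}{f}\Bigr)^2\phi+\frac{f'}{f}\,\phi'\Bigr\}dx,$$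 is the Darboux transform of $q$. For $\rho\in\mathbb C$ let $e_g(\rho,\cdot)\in\mathscr D_2(\mathbf S_g)$ be the solution of $\mathbf S_g e=\rho^2e$ on $(0,\ell)$ with $e(0)=1$ and $\mathbf D_ge(0)=i\rho$. For $g\in\{f,\tfrac1f\}$ there is a kernel $K_g$, square integrable on $\{(x,t):0\le x\le\ell,\ |t|\le x\}$ and with $K_g(x,\cdot)\in L^2(-x,x)$ for every $x\in(0,\ell)$, such that $$e_g(\rho,x)=e^{i\rho x}+\int_{-x}^{x}K_g(x,t)e^{i\rho t}\,dt\qquad(0<x<\ell,\ \rho\in\mathbb C).$$ For any such kernels $K_f$ and $K_{1/f}$, let $\mathbf T_gy(x)=y(x)+\int_{-x}^xK_g(x,t)y(t)\,dt$ for $y\in L^2(-\ell,\ell)$. Then: 1. $\mathbf T_f\bigl(W^{1,2}(-\ell,\ell)\bigr)\subset W^{1,2}(0,\ell)$, and $\mathbf D_f\mathbf T_fy=\mathbf T_{1/f}\,y'$ a.e. on $(0,\ell)$ for every $y\in W^{1,2}(-\ell,\ell)$. 2. $\mathbf T_f\bigl(W^{2,2}(-\ell,\ell)\bigr)\subset\mathscr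 D_2(\mathbf S_f)$, and $\mathbf S_f\mathbf T_fy=-\mathbf T_f\,y''$ in $L^2(0,\ell)$ for every $y\in W^{2,2}(-\ell,\ell)$. -/

import Mathlib

open MeasureTheory Set
open scoped ContDiff

noncomputable section

namespace DistSchrodinger

/-! Elements of `L²(a,b)` and of the Sobolev spaces are represented by functions `ℝ → ℂ`; only their
restriction to the interval, up to null sets, matters. -/

/-- The space `C₀^∞(a,b)` of complex-valued test functions. -/
def IsTestFunction (a b : ℝ) (φ : ℝ → ℂ) : Prop :=
  ContDiff ℝ ∞ φ ∧ HasCompactSupport φ ∧ tsupport φ ⊆ Ioo a b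

/-- `g` is the distributional derivative of `u` on `(a,b)`, both being regular distributions. -/
def HasWeakDeriv (a b : ℝ) (u g : ℝ → ℂ) : Prop :=
  LocallyIntegrableOn u (Ioo a b) ∧ LocallyIntegrableOn g (Ioo a b) ∧
    ∀ φ, IsTestFunction a b φ →
      ∫ x in Ioo a b, u x * deriv φ x = -∫ x in Ioo a b, g x * φ x

open Classical in
/-- The weak derivative of `u` on `(a,b)`, determined up to a null set
(and `0` if `u` has no weak derivative). -/
def weakDeriv (a b : ℝ) (u : ℝ → ℂ) : ℝ → ℂ :=
  if h : ∃ g, HasWeakDeriv a b u g then h.choose else 0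

/-- `u ∈ L²(a,b)`. -/
def MemL2 (a b : ℝ) (u : ℝ → ℂ) : Prop :=
  MemLp u 2 (volume.restrict (Ioo a b))

/-- `u ∈ W^{1,2}(a,b)`. -/
def MemW12 (a b : ℝ) (u : ℝ → ℂ) : Prop :=
  MemL2 a b u ∧ ∃ g, MemL2 a b g ∧ HasWeakDeriv a b u g

/-- `u ∈ W^{2,2}(a,b)`. -/
def MemW22 (a b : ℝ) (u : ℝ → ℂ) : Prop :=
  MemW12 a b u ∧ MemW12 a b (weakDeriv a b u)

/-- `u ∈ W₀^{1,2}(a,b)`: the continuous representative on `[a,b]` vanishes at both endpoints. -/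
def MemW12Zero (a b : ℝ) (u : ℝ → ℂ) : Prop :=
  MemW12 a b u ∧ ∃ v : ℝ → ℂ, ContinuousOn v (Icc a b) ∧
    u =ᵐ[volume.restrict (Ioo a b)] v ∧ v a = 0 ∧ v b = 0

/-- The norm of `W^{1,2}(a,b)`. -/
def normW12 (a b : ℝ) (u : ℝ → ℂ) : ℝ :=
  Real.sqrt ((∫ x in Ioo a b, ‖u x‖ ^ 2) + ∫ x in Ioo a b, ‖weakDeriv a b u x‖ ^ 2)

/-- `q ∈ W^{-1,2}(a,b)`: a bounded linear functional on `W₀^{1,2}(a,b)`.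
The values of `q` off `W₀^{1,2}(a,b)` are irrelevant. -/
structure IsNegSobolev (a b : ℝ) (q : (ℝ → ℂ) → ℂ) : Prop where
  map_add : ∀ φ ψ, MemW12Zero a b φ → MemW12Zero a b ψ → q (φ + ψ) = q φ + q ψ
  map_smul : ∀ (c : ℂ) (φ), MemW12Zero a b φ → q (c • φ) = c * q φ
  bounded : ∃ C : ℝ, ∀ φ, MemW12Zero a b φ → ‖q φ‖ ≤ C * normW12 a b φ

/-- The pairing `(S_q y | φ) = ∫ y' φ' + (q | y φ)`, where `S_q y = -y'' + q y`
as an element of `W^{-1,2}(a,b)`. -/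
def schrodingerPairing (a b : ℝ) (q : (ℝ → ℂ) → ℂ) (y φ : ℝ → ℂ) : ℂ :=
  (∫ x in Ioo a b, weakDeriv a b y x * weakDeriv a b φ x) + q (fun x => y x * φ x)

/-- `S_q y` is the `L²`-regular distribution given by `g ∈ L²(a,b)`, that is, `S_q y = g`. -/
def SchrodingerEq (a b : ℝ) (q : (ℝ → ℂ) → ℂ) (y g : ℝ → ℂ) : Prop :=
  MemL2 a b g ∧ ∀ φ, MemW12Zero a b φ →
    schrodingerPairing a b q y φ = ∫ x in Ioo a b, g x * φ x

/-- The domain of `L²`-regularization of `S_q`: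
those `y ∈ W^{1,2}(a,b)` for which `S_q y` is an `L²`-regular distribution. -/
def regularizationDomain (a b : ℝ) (q : (ℝ → ℂ) → ℂ) : Set (ℝ → ℂ) :=
  {y | MemW12 a b y ∧ ∃ g, SchrodingerEq a b q y g}

/-- `f` (taken as its continuous representative on `[a,b]`) is a nonvanishing solution
of `S_q f = 0`. -/
structure IsNonvanishingSolution (a b : ℝ) (q : (ℝ → ℂ) → ℂ) (f : ℝ → ℂ) : Prop where
  continuousOn : ContinuousOn f (Icc a b)
  mem_domain : f ∈ regularizationDomain a b q
  eq_zero : SchrodingerEq a b q f 0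
  ne_zero : ∀ x ∈ Icc a b, f x ≠ 0

/-- `D_f y = f (y / f)'`; hence `D_{1/f}` is `opD a b f⁻¹`. -/
def opD (a b : ℝ) (f y : ℝ → ℂ) : ℝ → ℂ :=
  fun x => f x * weakDeriv a b (fun s => y s / f s) x

/-- The distribution `q_f = f'' / f`,
`(q_f | φ) = ∫ ((f'/f)² φ - (f'/f) φ')`. -/
def potentialOf (a b : ℝ) (f : ℝ → ℂ) (φ : ℝ → ℂ) : ℂ :=
  ∫ x in Ioo a b, ((weakDeriv a b f x / f x) ^ 2 * φ x
    - weakDeriv a b f x / f x * weakDeriv a b φ x)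

/-- The Darboux transformation `q_{1/f} = f (1/f)''` of the potential `q = q_f`. -/
def darbouxPotential (a b : ℝ) (f : ℝ → ℂ) : (ℝ → ℂ) → ℂ :=
  potentialOf a b f⁻¹

/-- `e` is (the continuous representative of) the solution `e_f(ρ, ·)` on `(0,ℓ)` of
`S_q e = ρ² e`, `e(0) = 1`, `D_f e(0) = iρ`. The last value is that of the continuous representative
of `D_f e`. -/
structure IsExpSolution (ℓ : ℝ) (q : (ℝ → ℂ) → ℂ) (f : ℝ → ℂ) (ρ : ℂ) (e : ℝ → ℂ) : Prop where
  continuousOn : ContinuousOn e (Icc 0 ℓ)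
  mem_domain : e ∈ regularizationDomain 0 ℓ q
  eq : SchrodingerEq 0 ℓ q e (fun x => ρ ^ 2 * e x)
  init : e 0 = 1
  init_deriv : ∃ v : ℝ → ℂ, ContinuousOn v (Icc 0 ℓ) ∧
    opD 0 ℓ f e =ᵐ[volume.restrict (Ioo 0 ℓ)] v ∧ v 0 = Complex.I * ρ

/-- The triangle `0 ≤ x ≤ ℓ`, `|t| ≤ x`. -/
def triangle (ℓ : ℝ) : Set (ℝ × ℝ) :=
  {p | 0 ≤ p.1 ∧ p.1 ≤ ℓ ∧ |p.2| ≤ p.1}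

/-- The operator `T y(x) = y(x) + ∫_{-x}^{x} K(x,t) y(t) dt` with kernel `K`. -/
def transOp (K : ℝ → ℝ → ℂ) (y : ℝ → ℂ) : ℝ → ℂ :=
  fun x => y x + ∫ t in (-x)..x, K x t * y t

/-- `K` is the transmutation kernel `K_f`: it is square integrable on the triangle and on each of
its sections, and `e_f(ρ,x) = e^{iρx} + ∫_{-x}^{x} K(x,t) e^{iρt} dt` for all `ρ ∈ ℂ`, `0 < x < ℓ`.
This determines `K(x, ·)` almost everywhere on `(-x,x)` for each `x`. -/
structure IsTransmutationKernel (ℓ : ℝ) (q : (ℝ → ℂ) → ℂ) (f : ℝ → ℂ) (K : ℝ → ℝ → ℂ) : Prop where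
  memLp : MemLp (Function.uncurry K) 2 (volume.restrict (triangle ℓ))
  memLp_section : ∀ x ∈ Ioo 0 ℓ, MemL2 (-x) x (K x)
  representation : ∀ ρ : ℂ, ∃ e, IsExpSolution ℓ q f ρ e ∧
    ∀ x ∈ Ioo 0 ℓ, e x = transOp K (fun t : ℝ => Complex.exp (Complex.I * ρ * (t : ℂ))) x

end DistSchrodinger

end

/-!
With `p = f'/f` the equation `S_q f = 0` says that `q` is the Riccati potential `p² + p'`, so that
`S_q` factors into first-order operators: `e` solves `S_q e = ρ² e`, `e(0) = 1`, `D_f e(0) = iρ`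
precisely when, for some `e₁` with `e₁(0) = 1`, the two solve the system `D_f e = iρ e₁`,
`D_{1/f} e₁ = iρ e`, in which only `p ∈ L²` occurs. Exchanging `f` and `1/f` exchanges `e`
and `e₁`, that is, `D_f e_f = iρ e_{1/f}`. Iterating the integral form of the system gives the
kernel as a Volterra series.

For `y(t) = e^{iρt}` the identity `D_f T_f y = T_{1/f} y'` is `D_f e_f = iρ e_{1/f}`. In integrated
form both sides are bounded functionals of `y' ∈ L²(-ℓ, ℓ)`, and exponentials span a dense
subspace, so the identity holds throughout `W^{1,2}`. The second-order identity is the first-order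
one applied twice, the second time with `f` and `1/f` exchanged.
-/

open scoped Topology

namespace DistSchrodinger

/-! ### Primitives -/

section Primitives

variable {E : Type*} [NormedAddCommGroup E] [NormedSpace ℝ E]
variable {a b : ℝ} {u v g h : ℝ → E}

/-- `u` is absolutely continuous on `[a,b]` with derivative `g`, encoded by
`u(x) = u(a) + ∫_a^x g` for an integrable `g`. -/
structure IsPrimitive (a b : ℝ) (u g : ℝ → E) : Prop where
  le : a ≤ b
  intervalIntegrable : IntervalIntegrable g volume a b
  eq_add_integral : ∀ x ∈ Icc a b, u x = u a + ∫ t in a..x, g t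

theorem absolutelyContinuousOnInterval_of_dist_le_mul {X Y : Type*} [PseudoMetricSpace X]
    [PseudoMetricSpace Y] {F : ℝ → X} {G : ℝ → Y} {C : ℝ}
    (hF : AbsolutelyContinuousOnInterval F a b)
    (hFG : ∀ x ∈ uIcc a b, ∀ y ∈ uIcc a b, dist (G x) (G y) ≤ C * dist (F x) (F y)) :
    AbsolutelyContinuousOnInterval G a b := by
  rw [absolutelyContinuousOnInterval_iff] at hF ⊢
  intro ε hε
  obtain ⟨δ, hδ, hFδ⟩ := hF (ε / (|C| + 1)) (by positivity)
  refine ⟨δ, hδ, fun I hI hIδ => ?_⟩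
  calc ∑ i ∈ Finset.range I.1, dist (G (I.2 i).1) (G (I.2 i).2)
      ≤ ∑ i ∈ Finset.range I.1, (|C| + 1) * dist (F (I.2 i).1) (F (I.2 i).2) := by
        refine Finset.sum_le_sum fun i hi => (hFG _ (hI.1 i hi).1 _ (hI.1 i hi).2).trans ?_
        gcongr
        linarith [le_abs_self C]
    _ = (|C| + 1) * ∑ i ∈ Finset.range I.1, dist (F (I.2 i).1) (F (I.2 i).2) := by
        rw [Finset.mul_sum]
    _ < (|C| + 1) * (ε / (|C| + 1)) := by gcongr; exact hFδ I hI hIδ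
    _ = ε := by field_simp

theorem setIntegral_Ioo_eq (hab : a ≤ b) (g : ℝ → E) :
    ∫ x in Ioo a b, g x = ∫ x in a..b, g x := by
  rw [intervalIntegral.integral_of_le hab, integral_Ioc_eq_integral_Ioo]

theorem intervalIntegrable_of_mem_Icc {F : Type*} [NormedAddCommGroup F] {g : ℝ → F}
    (hg : IntervalIntegrable g volume a b) {x y : ℝ} (hx : x ∈ Icc a b) (hy : y ∈ Icc a b) :
    IntervalIntegrable g volume x y :=
  hg.mono_set (uIcc_subset_uIcc (Icc_subset_uIcc hx) (Icc_subset_uIcc hy))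

namespace IsPrimitive

theorem left_mem (hu : IsPrimitive a b u g) : a ∈ Icc a b := left_mem_Icc.2 hu.le

theorem right_mem (hu : IsPrimitive a b u g) : b ∈ Icc a b := right_mem_Icc.2 hu.le

theorem const_add_integral (hab : a ≤ b) (hg : IntervalIntegrable g volume a b) (c : E) :
    IsPrimitive a b (fun x => c + ∫ t in a..x, g t) g :=
  ⟨hab, hg, fun x _ => by simp⟩

theorem sub_eq_integral (hu : IsPrimitive a b u g) {x y : ℝ} (hx : x ∈ Icc a b)
    (hy : y ∈ Icc a b) : u y - u x = ∫ t in x..y, g t := by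
  have integrable_from_left : ∀ z ∈ Icc a b, IntervalIntegrable g volume a z := fun z =>
    intervalIntegrable_of_mem_Icc hu.intervalIntegrable hu.left_mem
  rw [hu.eq_add_integral x hx, hu.eq_add_integral y hy, add_sub_add_left_eq_sub,
    intervalIntegral.integral_interval_sub_left (integrable_from_left y hy)
      (integrable_from_left x hx)]

theorem absolutelyContinuous (hu : IsPrimitive a b u g) :
    AbsolutelyContinuousOnInterval u a b := by
  have norm_g := const_add_integral hu.le hu.intervalIntegrable.norm 0
  simp only [zero_add] at norm_g
  refine absolutelyContinuousOnInterval_of_dist_le_mul (C := 1)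
    (hu.intervalIntegrable.norm.absolutelyContinuousOnInterval_intervalIntegral
      (c := a) left_mem_uIcc) fun x hx y hy => ?_
  rw [uIcc_of_le hu.le] at hx hy
  rw [one_mul, dist_eq_norm, Real.dist_eq, hu.sub_eq_integral hy hx, norm_g.sub_eq_integral hy hx]
  exact intervalIntegral.norm_integral_le_abs_integral_norm

theorem continuousOn (hu : IsPrimitive a b u g) : ContinuousOn u (Icc a b) :=
  uIcc_of_le hu.le ▸ hu.absolutelyContinuous.continuousOn

theorem congr (hu : IsPrimitive a b u g) (hvu : EqOn v u (Icc a b))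
    (hgh : g =ᵐ[volume.restrict (Ioo a b)] h) : IsPrimitive a b v h := by
  rw [restrict_Ioo_eq_restrict_Ioc] at hgh
  refine ⟨hu.le, hu.intervalIntegrable.congr_ae (by rwa [uIoc_of_le hu.le]), fun x hx => ?_⟩
  rw [hvu hx, hvu hu.left_mem, hu.eq_add_integral x hx]
  congr 1
  refine intervalIntegral.integral_congr_ae_restrict ?_
  rw [uIoc_of_le hx.1]
  exact ae_restrict_of_ae_restrict_of_subset (Ioc_subset_Ioc_right hx.2) hgh

theorem eqOn (hu : IsPrimitive a b u g) (hv : IsPrimitive a b v g) (huv : u a = v a) :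
    EqOn u v (Icc a b) := fun x hx => by
  rw [hu.eq_add_integral x hx, hv.eq_add_integral x hx, huv]

theorem add (hu : IsPrimitive a b u g) (hv : IsPrimitive a b v h) :
    IsPrimitive a b (fun x => u x + v x) (fun x => g x + h x) := by
  refine ⟨hu.le, hu.intervalIntegrable.add hv.intervalIntegrable, fun x hx => ?_⟩
  rw [hu.eq_add_integral x hx, hv.eq_add_integral x hx, intervalIntegral.integral_add
    (intervalIntegrable_of_mem_Icc hu.intervalIntegrable hu.left_mem hx)
    (intervalIntegrable_of_mem_Icc hv.intervalIntegrable hu.left_mem hx)]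
  abel

variable [CompleteSpace E]

theorem ae_hasDerivAt (hu : IsPrimitive a b u g) :
    ∀ᵐ x, x ∈ uIcc a b → HasDerivAt u (g x) x := by
  filter_upwards [hu.intervalIntegrable.ae_hasDerivAt_integral, volume.ae_ne a, volume.ae_ne b]
    with x hderiv hxa hxb hx
  refine ((hderiv hx a left_mem_uIcc).const_add (u a)).congr_of_eventuallyEq ?_
  rw [uIcc_of_le hu.le] at hx
  filter_upwards [Ioo_mem_nhds (hx.1.lt_of_ne' hxa) (hx.2.lt_of_ne hxb)] with y hy
  exact hu.eq_add_integral y (Ioo_subset_Icc_self hy)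

theorem of_absolutelyContinuous (hab : a ≤ b) (hu : AbsolutelyContinuousOnInterval u a b)
    (hg : IntervalIntegrable g volume a b)
    (hderiv : ∀ᵐ x, x ∈ uIcc a b → HasDerivAt u (g x) x) : IsPrimitive a b u g := by
  have hG := const_add_integral hab hg (u a)
  obtain ⟨c, hc⟩ := (hu.sub hG.absolutelyContinuous).const_of_ae_hasDerivAt_zero (by
    filter_upwards [hderiv, hG.ae_hasDerivAt] with x hux hGx hx
    simpa using (hux hx).sub (hGx hx))
  have hc0 : c = 0 := by simp [← hc a left_mem_uIcc]
  exact ⟨hab, hg, fun x hx => sub_eq_zero.1 ((hc x (Icc_subset_uIcc hx)).trans hc0)⟩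

theorem of_hasDerivAt (hab : a ≤ b) (hderiv : ∀ x, HasDerivAt u (g x) x) (hg : Continuous g) :
    IsPrimitive a b u g := by
  refine ⟨hab, hg.intervalIntegrable a b, fun x _ => ?_⟩
  rw [intervalIntegral.integral_eq_sub_of_hasDerivAt (fun x _ => hderiv x)
    (hg.intervalIntegrable a x), add_sub_cancel]

section RCLike

variable {𝕜 : Type*} [RCLike 𝕜] {u v g h : ℝ → 𝕜}

theorem const_mul (hu : IsPrimitive a b u g) (c : 𝕜) :
    IsPrimitive a b (fun x => c * u x) (fun x => c * g x) := by
  refine ⟨hu.le, hu.intervalIntegrable.const_mul c, fun x hx => ?_⟩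
  rw [hu.eq_add_integral x hx, intervalIntegral.integral_const_mul, mul_add]

theorem mul (hu : IsPrimitive a b u g) (hv : IsPrimitive a b v h) :
    IsPrimitive a b (fun x => u x * v x) (fun x => g x * v x + u x * h x) := by
  refine of_absolutelyContinuous hu.le (hu.absolutelyContinuous.smul hv.absolutelyContinuous)
    ((hu.intervalIntegrable.mul_continuousOn hv.absolutelyContinuous.continuousOn).add
      (hv.intervalIntegrable.continuousOn_mul hu.absolutelyContinuous.continuousOn)) ?_
  filter_upwards [hu.ae_hasDerivAt, hv.ae_hasDerivAt] with x hux hvx hx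
  exact (hux hx).mul (hvx hx)

theorem integral_deriv_mul_add_integral_mul_deriv (hu : IsPrimitive a b u g)
    (hv : IsPrimitive a b v h) :
    (∫ x in Ioo a b, g x * v x) + ∫ x in Ioo a b, u x * h x = u b * v b - u a * v a := by
  rw [setIntegral_Ioo_eq hu.le, setIntegral_Ioo_eq hu.le, ← intervalIntegral.integral_add
    (hu.intervalIntegrable.mul_continuousOn hv.absolutelyContinuous.continuousOn)
    (hv.intervalIntegrable.continuousOn_mul hu.absolutelyContinuous.continuousOn)]
  exact ((hu.mul hv).sub_eq_integral hu.left_mem hu.right_mem).symm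

theorem inv (hu : IsPrimitive a b u g) (hu0 : ∀ x ∈ Icc a b, u x ≠ 0) :
    IsPrimitive a b (fun x => (u x)⁻¹) (fun x => -g x / u x ^ 2) := by
  have continuousOn_inv : ContinuousOn (fun x => (u x)⁻¹) (Icc a b) := hu.continuousOn.inv₀ hu0
  obtain ⟨C, hC⟩ := isCompact_Icc.exists_bound_of_continuousOn continuousOn_inv
  rw [← uIcc_of_le hu.le] at continuousOn_inv hu0 hC
  refine of_absolutelyContinuous hu.le (absolutelyContinuousOnInterval_of_dist_le_mul (C := C * C)
    hu.absolutelyContinuous fun x hx y hy => ?_) ?_ ?_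
  · rw [dist_eq_norm, dist_comm, dist_eq_norm, inv_sub_inv (hu0 x hx) (hu0 y hy),
      div_eq_inv_mul, mul_inv, norm_mul, norm_mul]
    gcongr
    · exact (norm_nonneg _).trans (hC x hx)
    · exact hC x hx
    · exact hC y hy
  · refine (hu.intervalIntegrable.mul_continuousOn (continuousOn_inv.pow 2).neg).congr_ae
      (.of_forall fun x => ?_)
    simp only [Pi.neg_apply, Pi.pow_apply]
    ring
  · filter_upwards [hu.ae_hasDerivAt] with x hux hx
    exact (hux hx).inv (hu0 x hx)

end RCLike

end IsPrimitive

end Primitives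

/-! ### Weak derivatives -/

section TestFunctions

variable {a b : ℝ} {φ ψ u : ℝ → ℂ}

namespace IsTestFunction

theorem apply_of_notMem (hφ : IsTestFunction a b φ) {x : ℝ} (hx : x ∉ Ioo a b) : φ x = 0 :=
  image_eq_zero_of_notMem_tsupport fun hx' => hx (hφ.2.2 hx')

theorem deriv (hφ : IsTestFunction a b φ) : IsTestFunction a b (deriv φ) :=
  ⟨(contDiff_infty_iff_deriv.1 hφ.1).2, hφ.2.1.deriv, tsupport_deriv_subset.trans hφ.2.2⟩

theorem sub (hφ : IsTestFunction a b φ) (hψ : IsTestFunction a b ψ) :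
    IsTestFunction a b (fun x => φ x - ψ x) :=
  ⟨hφ.1.sub hψ.1, hφ.2.1.sub hψ.2.1, (tsupport_sub φ ψ).trans (union_subset hφ.2.2 hψ.2.2)⟩

theorem const_mul (hφ : IsTestFunction a b φ) (c : ℂ) :
    IsTestFunction a b (fun x => c * φ x) :=
  ⟨contDiff_const.mul hφ.1, hφ.2.1.mul_left, (tsupport_mul_subset_right).trans hφ.2.2⟩

theorem ofReal {η : ℝ → ℝ} (hη : ContDiff ℝ ∞ η) (hηc : HasCompactSupport η)
    (hηs : tsupport η ⊆ Ioo a b) : IsTestFunction a b (fun x => (η x : ℂ)) := by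
  have support_eq : Function.support (fun x => (η x : ℂ)) = Function.support η := by
    ext x; simp
  have tsupport_eq : tsupport (fun x => (η x : ℂ)) = tsupport η := by
    rw [tsupport, tsupport, support_eq]
  exact ⟨Complex.ofRealCLM.contDiff.comp hη, hηc.comp_left Complex.ofReal_zero,
    tsupport_eq ▸ hηs⟩

theorem integrableOn_mul (hφ : IsTestFunction a b φ) (hu : LocallyIntegrableOn u (Ioo a b)) :
    IntegrableOn (fun x => u x * φ x) (Ioo a b) := by
  have integrableOn_tsupport : IntegrableOn (fun x => u x * φ x) (tsupport φ) :=
    (hu.integrableOn_compact_subset hφ.2.2 hφ.2.1).mul_continuousOn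
      hφ.1.continuous.continuousOn hφ.2.1
  refine Integrable.integrableOn ((integrableOn_iff_integrable_of_support_subset ?_).1
    integrableOn_tsupport)
  exact fun x hx => subset_tsupport φ (right_ne_zero_of_mul hx)

theorem isPrimitive (hab : a ≤ b) (hφ : IsTestFunction a b φ) :
    IsPrimitive a b φ (_root_.deriv φ) :=
  .of_hasDerivAt hab (fun x => (hφ.1.differentiable (by simp) x).hasDerivAt)
    hφ.deriv.1.continuous

theorem exists_tsupport_subset_Icc (hφ : IsTestFunction a b φ) :
    ∃ c d, a < c ∧ d < b ∧ tsupport φ ⊆ Icc c d := by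
  obtain h | h := (tsupport φ).eq_empty_or_nonempty
  · exact ⟨a + 1, b - 1, by simp, by simp, by simp [h]⟩
  · obtain ⟨c, hc, hcl⟩ := IsCompact.exists_isLeast hφ.2.1 h
    obtain ⟨d, hd, hdg⟩ := IsCompact.exists_isGreatest hφ.2.1 h
    exact ⟨c, d, (hφ.2.2 hc).1, (hφ.2.2 hd).2, fun x hx => ⟨hcl hx, hdg hx⟩⟩

theorem deriv_integral (hψ : IsTestFunction a b ψ) :
    _root_.deriv (fun x => ∫ t in a..x, ψ t) = ψ :=
  funext fun x => (hψ.1.continuous.integral_hasStrictDerivAt a x).hasDerivAt.deriv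

theorem integral (hψ : IsTestFunction a b ψ) (hmean : ∫ x in Ioo a b, ψ x = 0) :
    IsTestFunction a b (fun x => ∫ t in a..x, ψ t) := by
  obtain ⟨c, d, hac, hdb, hcd⟩ := hψ.exists_tsupport_subset_Icc
  have support_subset : Function.support ψ ⊆ Icc c d := (subset_tsupport ψ).trans hcd
  have integral_eq_zero : ∀ x ∉ Icc c d, ∫ t in a..x, ψ t = 0 := fun x hx => by
    obtain hxc | hdx : x < c ∨ d < x := by
      simpa only [mem_Icc, not_and_or, not_le] using hx
    · refine intervalIntegral.integral_zero_ae (.of_forall fun t ht => ?_)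
      refine Function.notMem_support.1 fun ht' => ?_
      exact (ht.2.trans_lt (max_lt hac hxc)).not_ge (support_subset ht').1
    · rw [intervalIntegral.integral_eq_integral_of_support_subset
        (support_subset.trans fun t ht => ⟨hac.trans_le ht.1, ht.2.trans hdx.le⟩), ← hmean,
        setIntegral_eq_integral_of_forall_compl_eq_zero fun x => hψ.apply_of_notMem]
  have tsupport_subset : tsupport (fun x => ∫ t in a..x, ψ t) ⊆ Icc c d :=
    closure_minimal (fun x hx => by_contra fun hx' => hx (integral_eq_zero x hx')) isClosed_Icc
  refine ⟨contDiff_infty_iff_deriv.2 ⟨fun x => ?_, ?_⟩,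
    isCompact_Icc.of_isClosed_subset (isClosed_tsupport _) tsupport_subset,
    tsupport_subset.trans (Icc_subset_Ioo hac hdb)⟩
  · exact (hψ.1.continuous.integral_hasStrictDerivAt a x).hasDerivAt.differentiableAt
  · rw [hψ.deriv_integral]
    exact hψ.1

end IsTestFunction

theorem exists_isTestFunction_integral_eq_one (hab : a < b) :
    ∃ θ, IsTestFunction a b θ ∧ ∫ x in Ioo a b, θ x = 1 := by
  let bump : ContDiffBump ((a + b) / 2) := ⟨(b - a) / 8, (b - a) / 4, by linarith, by linarith⟩
  have tsupport_subset : tsupport (bump.normed volume) ⊆ Ioo a b := by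
    rw [bump.tsupport_normed_eq, Real.closedBall_eq_Icc]
    exact Icc_subset_Ioo (by change a < _ - (b - a) / 4; linarith)
      (by change _ + (b - a) / 4 < b; linarith)
  have isTestFunction : IsTestFunction a b (fun x => (bump.normed volume x : ℂ)) :=
    .ofReal bump.contDiff_normed bump.hasCompactSupport_normed tsupport_subset
  refine ⟨_, isTestFunction, ?_⟩
  rw [setIntegral_eq_integral_of_forall_compl_eq_zero fun x => isTestFunction.apply_of_notMem,
    integral_complex_ofReal, bump.integral_normed, Complex.ofReal_one]

theorem ae_eq_zero_of_forall_integral_mul_eq_zero (hu : LocallyIntegrableOn u (Ioo a b))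
    (h : ∀ φ, IsTestFunction a b φ → ∫ x in Ioo a b, u x * φ x = 0) :
    u =ᵐ[volume.restrict (Ioo a b)] 0 := by
  refine (ae_restrict_iff' measurableSet_Ioo).2
    (isOpen_Ioo.ae_eq_zero_of_integral_contDiff_smul_eq_zero hu fun η hη hηc hηs => ?_)
  have isTestFunction := IsTestFunction.ofReal hη hηc hηs
  rw [← h _ isTestFunction, setIntegral_eq_integral_of_forall_compl_eq_zero fun x hx => by
    rw [isTestFunction.apply_of_notMem hx, mul_zero]]
  exact integral_congr_ae (.of_forall fun x => by simp [mul_comm])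

/-- The lemma of du Bois-Reymond. -/
theorem ae_eq_const_of_forall_integral_mul_deriv_eq_zero (hab : a < b)
    (hu : LocallyIntegrableOn u (Ioo a b))
    (h : ∀ φ, IsTestFunction a b φ → ∫ x in Ioo a b, u x * deriv φ x = 0) :
    ∃ c : ℂ, u =ᵐ[volume.restrict (Ioo a b)] fun _ => c := by
  obtain ⟨θ, hθ, hθ1⟩ := exists_isTestFunction_integral_eq_one hab
  refine ⟨∫ x in Ioo a b, u x * θ x, ?_⟩
  set c := ∫ x in Ioo a b, u x * θ x with hc
  have locallyIntegrableOn_const : LocallyIntegrableOn (fun _ : ℝ => c) (Ioo a b) :=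
    continuousOn_const.locallyIntegrableOn measurableSet_Ioo
  suffices (fun x => u x - c) =ᵐ[volume.restrict (Ioo a b)] 0 by
    filter_upwards [this] with x hx using sub_eq_zero.1 hx
  refine ae_eq_zero_of_forall_integral_mul_eq_zero (hu.sub locallyIntegrableOn_const) fun ψ hψ => ?_
  -- Subtracting a multiple of `θ` from `ψ` leaves a function with zero mean, hence a derivative.
  have integrableOn_ψ : IntegrableOn ψ (Ioo a b) :=
    (hψ.1.continuous.integrable_of_hasCompactSupport hψ.2.1).integrableOn
  have integrableOn_θ : IntegrableOn θ (Ioo a b) :=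
    (hθ.1.continuous.integrable_of_hasCompactSupport hθ.2.1).integrableOn
  set m := ∫ x in Ioo a b, ψ x
  have isTestFunction := hψ.sub (hθ.const_mul m)
  have zero_mean : ∫ x in Ioo a b, (ψ x - m * θ x) = 0 := by
    rw [integral_sub integrableOn_ψ (integrableOn_θ.const_mul m), integral_const_mul, hθ1,
      mul_one, sub_self]
  have orthogonal := h _ (isTestFunction.integral zero_mean)
  rw [isTestFunction.deriv_integral] at orthogonal
  calc ∫ x in Ioo a b, (u x - c) * ψ x
      = (∫ x in Ioo a b, u x * ψ x) - c * m := by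
        simp only [sub_mul]
        rw [integral_sub (hψ.integrableOn_mul hu) (integrableOn_ψ.const_mul c), integral_const_mul]
    _ = ∫ x in Ioo a b, u x * (ψ x - m * θ x) := by
        rw [hc, mul_comm, ← integral_const_mul, ← integral_sub (hψ.integrableOn_mul hu)
          ((hθ.integrableOn_mul hu).const_mul m)]
        exact integral_congr_ae (.of_forall fun x => by ring)
    _ = 0 := orthogonal

end TestFunctions

section WeakDerivatives

variable {a b : ℝ} {u v g h : ℝ → ℂ}

namespace HasWeakDeriv

theorem congr (hu : HasWeakDeriv a b u g) (huv : u =ᵐ[volume.restrict (Ioo a b)] v) :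
    HasWeakDeriv a b v g := by
  refine ⟨fun x hx => ?_, hu.2.1, fun φ hφ => ?_⟩
  · obtain ⟨s, hs, hus⟩ := hu.1 x hx
    refine ⟨s ∩ Ioo a b, Filter.inter_mem hs self_mem_nhdsWithin, ?_⟩
    exact (hus.mono_set inter_subset_left).congr
      (ae_restrict_of_ae_restrict_of_subset inter_subset_right huv)
  · rw [← hu.2.2 φ hφ]
    refine integral_congr_ae ?_
    filter_upwards [huv] with x hx
    rw [hx]

theorem ae_eq (hu : HasWeakDeriv a b u g) (hv : HasWeakDeriv a b u h) :
    g =ᵐ[volume.restrict (Ioo a b)] h := by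
  suffices (fun x => g x - h x) =ᵐ[volume.restrict (Ioo a b)] 0 by
    filter_upwards [this] with x hx using sub_eq_zero.1 hx
  refine ae_eq_zero_of_forall_integral_mul_eq_zero (hu.2.1.sub hv.2.1) fun φ hφ => ?_
  simp only [sub_mul]
  rw [integral_sub (hφ.integrableOn_mul hu.2.1) (hφ.integrableOn_mul hv.2.1), sub_eq_zero,
    ← neg_inj, ← hu.2.2 φ hφ, ← hv.2.2 φ hφ]

theorem weakDeriv (hu : HasWeakDeriv a b u g) : HasWeakDeriv a b u (weakDeriv a b u) := by
  have exists_hasWeakDeriv : ∃ g, HasWeakDeriv a b u g := ⟨g, hu⟩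
  rw [DistSchrodinger.weakDeriv, dif_pos exists_hasWeakDeriv]
  exact exists_hasWeakDeriv.choose_spec

end HasWeakDeriv

theorem IsPrimitive.hasWeakDeriv (hu : IsPrimitive a b u g) : HasWeakDeriv a b u g := by
  refine ⟨(hu.continuousOn.mono Ioo_subset_Icc_self).locallyIntegrableOn measurableSet_Ioo,
    ((intervalIntegrable_iff_integrableOn_Ioo_of_le hu.le).1
      hu.intervalIntegrable).locallyIntegrableOn, fun φ hφ => ?_⟩
  have by_parts := hu.integral_deriv_mul_add_integral_mul_deriv (hφ.isPrimitive hu.le)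
  rw [hφ.apply_of_notMem left_notMem_Ioo, hφ.apply_of_notMem right_notMem_Ioo, mul_zero, mul_zero,
    sub_zero] at by_parts
  exact eq_neg_of_add_eq_zero_right by_parts

theorem HasWeakDeriv.exists_isPrimitive (hab : a < b) (hu : HasWeakDeriv a b u g)
    (hg : IntegrableOn g (Ioo a b)) :
    ∃ v, IsPrimitive a b v g ∧ u =ᵐ[volume.restrict (Ioo a b)] v := by
  have isPrimitive := IsPrimitive.const_add_integral hab.le
    ((intervalIntegrable_iff_integrableOn_Ioo_of_le hab.le).2 hg)
  have hasWeakDeriv := (isPrimitive 0).hasWeakDeriv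
  obtain ⟨c, hc⟩ := ae_eq_const_of_forall_integral_mul_deriv_eq_zero hab
    (hu.1.sub hasWeakDeriv.1) fun φ hφ => by
      simp only [Pi.sub_apply, sub_mul]
      rw [integral_sub (hφ.deriv.integrableOn_mul hu.1)
        (hφ.deriv.integrableOn_mul hasWeakDeriv.1), hu.2.2 φ hφ, hasWeakDeriv.2.2 φ hφ, sub_self]
  refine ⟨_, isPrimitive c, ?_⟩
  filter_upwards [hc] with x hx
  rw [← hx, Pi.sub_apply, zero_add, sub_add_cancel]

end WeakDerivatives

/-! ### Square integrable functions and Sobolev functions -/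

section MemL2

variable {a b : ℝ} {u v : ℝ → ℂ}

theorem memL2_of_continuousOn (hu : ContinuousOn u (Icc a b)) : MemL2 a b u := by
  obtain ⟨C, hC⟩ := isCompact_Icc.exists_bound_of_continuousOn hu
  refine MemLp.of_bound ((hu.mono Ioo_subset_Icc_self).aestronglyMeasurable measurableSet_Ioo) C ?_
  exact (ae_restrict_iff' measurableSet_Ioo).2
    (.of_forall fun x hx => hC x (Ioo_subset_Icc_self hx))

namespace MemL2

theorem integrableOn (hu : MemL2 a b u) : IntegrableOn u (Ioo a b) :=
  MemLp.integrable (q := 2) (by norm_num) hu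

theorem intervalIntegrable (hab : a ≤ b) (hu : MemL2 a b u) : IntervalIntegrable u volume a b :=
  (intervalIntegrable_iff_integrableOn_Ioo_of_le hab).2 hu.integrableOn

theorem neg (hu : MemL2 a b u) : MemL2 a b (fun x => -u x) :=
  MemLp.neg hu

theorem add (hu : MemL2 a b u) (hv : MemL2 a b v) : MemL2 a b (fun x => u x + v x) :=
  MemLp.add hu hv

theorem sub (hu : MemL2 a b u) (hv : MemL2 a b v) : MemL2 a b (fun x => u x - v x) :=
  MemLp.sub hu hv

theorem integrableOn_mul (hu : MemL2 a b u) (hv : MemL2 a b v) :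
    IntegrableOn (fun x => u x * v x) (Ioo a b) :=
  MemLp.integrable_mul hu hv

theorem continuousOn_mul (hv : MemL2 a b v) (hu : ContinuousOn u (Icc a b)) :
    MemL2 a b (fun x => u x * v x) := by
  obtain ⟨C, hC⟩ := isCompact_Icc.exists_bound_of_continuousOn hu
  refine MemLp.of_le_mul (c := C) hv (((hu.mono Ioo_subset_Icc_self).aestronglyMeasurable
    measurableSet_Ioo).mul hv.1) ?_
  refine (ae_restrict_iff' measurableSet_Ioo).2 (.of_forall fun x hx => ?_)
  rw [norm_mul]
  gcongr
  exact hC x (Ioo_subset_Icc_self hx)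

theorem mul_continuousOn (hu : MemL2 a b u) (hv : ContinuousOn v (Icc a b)) :
    MemL2 a b (fun x => u x * v x) := by
  simpa only [mul_comm] using hu.continuousOn_mul hv

end MemL2

end MemL2

section Sobolev

variable {a b : ℝ} {Y y y' Z z z' : ℝ → ℂ}

/-- `Y ∈ W^{1,2}(a,b)` has the absolutely continuous representative `y`, whose derivative is
`y' ∈ L²(a,b)`. -/
structure HasACRepr (a b : ℝ) (Y y y' : ℝ → ℂ) : Prop where
  isPrimitive : IsPrimitive a b y y'
  memL2_deriv : MemL2 a b y'
  ae_eq : Y =ᵐ[volume.restrict (Ioo a b)] y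

theorem IsPrimitive.hasACRepr (hy : IsPrimitive a b y y') (hy' : MemL2 a b y') :
    HasACRepr a b y y y' :=
  ⟨hy, hy', ae_eq_refl _⟩

namespace HasACRepr

theorem continuousOn (hY : HasACRepr a b Y y y') : ContinuousOn y (Icc a b) :=
  hY.isPrimitive.continuousOn

theorem hasWeakDeriv (hY : HasACRepr a b Y y y') : HasWeakDeriv a b Y y' :=
  hY.isPrimitive.hasWeakDeriv.congr hY.ae_eq.symm

theorem weakDeriv_ae_eq (hY : HasACRepr a b Y y y') :
    weakDeriv a b Y =ᵐ[volume.restrict (Ioo a b)] y' :=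
  hY.hasWeakDeriv.weakDeriv.ae_eq hY.hasWeakDeriv

theorem memW12 (hY : HasACRepr a b Y y y') : MemW12 a b Y :=
  ⟨(memL2_of_continuousOn hY.continuousOn).ae_eq hY.ae_eq.symm, y', hY.memL2_deriv,
    hY.hasWeakDeriv⟩

theorem memW12Zero (hY : HasACRepr a b Y y y') (ha : y a = 0) (hb : y b = 0) :
    MemW12Zero a b Y :=
  ⟨hY.memW12, y, hY.continuousOn, hY.ae_eq, ha, hb⟩

theorem mul (hY : HasACRepr a b Y y y') (hZ : HasACRepr a b Z z z') :
    HasACRepr a b (fun x => Y x * Z x) (fun x => y x * z x)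
      (fun x => y' x * z x + y x * z' x) :=
  ⟨hY.isPrimitive.mul hZ.isPrimitive, (hY.memL2_deriv.mul_continuousOn hZ.continuousOn).add
    (hZ.memL2_deriv.continuousOn_mul hY.continuousOn), hY.ae_eq.mul hZ.ae_eq⟩

end HasACRepr

theorem MemW12.exists_hasACRepr (hab : a < b) (hY : MemW12 a b Y) :
    ∃ y, HasACRepr a b Y y (weakDeriv a b Y) := by
  obtain ⟨_, g, memL2_g, hasWeakDeriv_g⟩ := hY
  have memL2_weakDeriv : MemL2 a b (weakDeriv a b Y) :=
    memL2_g.ae_eq (hasWeakDeriv_g.ae_eq hasWeakDeriv_g.weakDeriv)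
  obtain ⟨y, hy, hYy⟩ := hasWeakDeriv_g.weakDeriv.exists_isPrimitive hab
    memL2_weakDeriv.integrableOn
  exact ⟨y, hy, memL2_weakDeriv, hYy⟩

theorem MemW12.hasACRepr (hab : a < b) (hY : MemW12 a b Y) (hy : ContinuousOn y (Icc a b))
    (hYy : Y =ᵐ[volume.restrict (Ioo a b)] y) : HasACRepr a b Y y (weakDeriv a b Y) := by
  obtain ⟨w, hw⟩ := hY.exists_hasACRepr hab
  have eqOn : EqOn y w (Icc a b) := Measure.eqOn_Icc_of_ae_eq volume hab.ne
    (by rw [← restrict_Ioo_eq_restrict_Icc]; exact hYy.symm.trans hw.ae_eq) hy hw.continuousOn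
  exact ⟨hw.isPrimitive.congr eqOn (ae_eq_refl _), hw.memL2_deriv, hYy⟩

theorem MemW12Zero.exists_hasACRepr (hab : a < b) (hY : MemW12Zero a b Y) :
    ∃ y, HasACRepr a b Y y (weakDeriv a b Y) ∧ y a = 0 ∧ y b = 0 := by
  obtain ⟨memW12, y, hy, hYy, hya, hyb⟩ := hY
  exact ⟨y, memW12.hasACRepr hab hy hYy, hya, hyb⟩

theorem IsNegSobolev.apply_eq_of_ae_eq (hab : a ≤ b) {q : (ℝ → ℂ) → ℂ} (hq : IsNegSobolev a b q)
    (hZ : MemW12Zero a b Z) (hYZ : Y =ᵐ[volume.restrict (Ioo a b)] Z) : q Y = q Z := by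
  have hasACRepr_sub : HasACRepr a b (Y - Z) (fun _ => 0) (fun _ => 0) := by
    refine ⟨⟨hab, by simp, by simp⟩, memL2_of_continuousOn continuousOn_const, ?_⟩
    filter_upwards [hYZ] with x hx
    simp [hx]
  have memW12Zero_sub : MemW12Zero a b (Y - Z) := hasACRepr_sub.memW12Zero rfl rfl
  have normW12_sub : normW12 a b (Y - Z) = 0 := by
    have sub_zero : ∫ x in Ioo a b, ‖(Y - Z) x‖ ^ 2 = 0 :=
      integral_eq_zero_of_ae (by filter_upwards [hasACRepr_sub.ae_eq] with x hx; simp [hx])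
    have deriv_zero : ∫ x in Ioo a b, ‖weakDeriv a b (Y - Z) x‖ ^ 2 = 0 :=
      integral_eq_zero_of_ae
        (by filter_upwards [hasACRepr_sub.weakDeriv_ae_eq] with x hx; simp [hx])
    rw [normW12, sub_zero, deriv_zero, add_zero, Real.sqrt_zero]
  obtain ⟨C, hC⟩ := hq.bounded
  have apply_sub : q (Y - Z) = 0 :=
    norm_le_zero_iff.1 (by simpa only [normW12_sub, mul_zero] using hC _ memW12Zero_sub)
  simpa only [sub_add_cancel, apply_sub, zero_add] using hq.map_add _ _ memW12Zero_sub hZ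

end Sobolev

/-! ### Riccati potentials -/

section Riccati

variable {a b : ℝ} {f p Y y y' Z z z' g B : ℝ → ℂ} {q : (ℝ → ℂ) → ℂ}

/-- `f` is absolutely continuous and nonvanishing on `[a,b]`, with logarithmic derivative
`f'/f = p ∈ L²(a,b)`. -/
structure HasLogDeriv (a b : ℝ) (f p : ℝ → ℂ) : Prop where
  isPrimitive : IsPrimitive a b f (fun x => p x * f x)
  memL2 : MemL2 a b p
  ne_zero : ∀ x ∈ Icc a b, f x ≠ 0

/-- `q` is the distribution `p² + p'`, so that `p` solves the Riccati equation of `q`; only the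
values of `q` on `W₀^{1,2}(a,b)` matter. -/
def IsRiccatiPotential (a b : ℝ) (q : (ℝ → ℂ) → ℂ) (p : ℝ → ℂ) : Prop :=
  ∀ φ, MemW12Zero a b φ →
    q φ = ∫ x in Ioo a b, (p x ^ 2 * φ x - p x * weakDeriv a b φ x)

namespace HasLogDeriv

theorem ae_ne_zero (hf : HasLogDeriv a b f p) : ∀ᵐ x ∂volume.restrict (Ioo a b), f x ≠ 0 := by
  filter_upwards [ae_restrict_mem measurableSet_Ioo] with x hx
  exact hf.ne_zero x (Ioo_subset_Icc_self hx)

theorem continuousOn (hf : HasLogDeriv a b f p) : ContinuousOn f (Icc a b) :=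
  hf.isPrimitive.continuousOn

theorem hasACRepr (hf : HasLogDeriv a b f p) : HasACRepr a b f f (fun x => p x * f x) :=
  hf.isPrimitive.hasACRepr (hf.memL2.mul_continuousOn hf.continuousOn)

theorem inv (hf : HasLogDeriv a b f p) : HasLogDeriv a b f⁻¹ (-p) := by
  refine ⟨(hf.isPrimitive.inv hf.ne_zero).congr (fun x _ => rfl) ?_, hf.memL2.neg,
    fun x hx => inv_ne_zero (hf.ne_zero x hx)⟩
  filter_upwards [hf.ae_ne_zero] with x hfx
  simp only [Pi.neg_apply, Pi.inv_apply]
  field_simp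

theorem div (hf : HasLogDeriv a b f p) (hY : HasACRepr a b Y y y') :
    HasACRepr a b (fun x => Y x / f x) (fun x => y x / f x)
      (fun x => (y' x - p x * y x) / f x) := by
  convert hY.mul hf.inv.hasACRepr using 2 with x x <;>
    simp only [Pi.neg_apply, Pi.inv_apply] <;> ring

theorem opD_ae_eq (hf : HasLogDeriv a b f p) (hY : HasACRepr a b Y y y') :
    opD a b f Y =ᵐ[volume.restrict (Ioo a b)] fun x => y' x - p x * y x := by
  filter_upwards [(hf.div hY).weakDeriv_ae_eq, hf.ae_ne_zero] with x hx hfx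
  rw [opD, hx, mul_div_cancel₀ _ hfx]

theorem isRiccatiPotential_potentialOf (hf : HasLogDeriv a b f p) :
    IsRiccatiPotential a b (potentialOf a b f) p := by
  intro φ _
  refine integral_congr_ae ?_
  filter_upwards [hf.hasACRepr.weakDeriv_ae_eq, hf.ae_ne_zero] with x hx hfx
  rw [hx, mul_div_cancel_right₀ _ hfx]

end HasLogDeriv

namespace IsNonvanishingSolution

theorem hasLogDeriv (hab : a < b) (hf : IsNonvanishingSolution a b q f) :
    HasLogDeriv a b f (fun x => weakDeriv a b f x / f x) := by
  have hasACRepr := hf.mem_domain.1.hasACRepr hab hf.continuousOn (ae_eq_refl _)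
  refine ⟨hasACRepr.isPrimitive.congr (fun _ _ => rfl) ?_, ?_, hf.ne_zero⟩
  · filter_upwards [ae_restrict_mem measurableSet_Ioo] with x hx
    exact (div_mul_cancel₀ _ (hf.ne_zero x (Ioo_subset_Icc_self hx))).symm
  · simpa only [div_eq_mul_inv, Pi.inv_apply] using
      hasACRepr.memL2_deriv.mul_continuousOn (hf.continuousOn.inv₀ hf.ne_zero)

theorem isRiccatiPotential (hab : a < b) (hq : IsNegSobolev a b q)
    (hf : IsNonvanishingSolution a b q f) :
    IsRiccatiPotential a b q (fun x => weakDeriv a b f x / f x) := by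
  intro φ hφ
  obtain ⟨v, hv, hva, hvb⟩ := hφ.exists_hasACRepr hab
  have hasLogDeriv := hf.hasLogDeriv hab
  have hasACRepr_div := hasLogDeriv.div hv
  have pairing_eq_zero := hf.eq_zero.2 _ (hasACRepr_div.memW12Zero (by simp [hva]) (by simp [hvb]))
  have mul_div_ae_eq : (fun x => f x * (φ x / f x)) =ᵐ[volume.restrict (Ioo a b)] φ := by
    filter_upwards [hasLogDeriv.ae_ne_zero] with x hfx
    exact mul_div_cancel₀ _ hfx
  rw [schrodingerPairing, hq.apply_eq_of_ae_eq hab.le hφ mul_div_ae_eq] at pairing_eq_zero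
  simp only [Pi.zero_apply, zero_mul, integral_zero] at pairing_eq_zero
  rw [eq_neg_of_add_eq_zero_right pairing_eq_zero, ← integral_neg]
  refine integral_congr_ae ?_
  filter_upwards [hasACRepr_div.weakDeriv_ae_eq, hv.ae_eq, hasLogDeriv.ae_ne_zero] with x hx hφx hfx
  rw [hx, hφx]
  field_simp
  ring

end IsNonvanishingSolution

namespace IsRiccatiPotential

/-- The weak form of `S_q = -D_{1/f} D_f`. -/
theorem schrodingerPairing_eq (hp : MemL2 a b p) (hq : IsRiccatiPotential a b q p)
    (hY : HasACRepr a b Y y y') (hZ : HasACRepr a b Z z z') (hza : z a = 0) (hzb : z b = 0) :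
    schrodingerPairing a b q Y Z
      = ∫ x in Ioo a b, (y' x - p x * y x) * (z' x - p x * z x) := by
  have hYZ := hY.mul hZ
  have integral_deriv_mul_deriv : ∫ x in Ioo a b, weakDeriv a b Y x * weakDeriv a b Z x
      = ∫ x in Ioo a b, y' x * z' x := by
    refine integral_congr_ae ?_
    filter_upwards [hY.weakDeriv_ae_eq, hZ.weakDeriv_ae_eq] with x hYx hZx
    rw [hYx, hZx]
  have potential_apply : q (fun x => Y x * Z x)
      = ∫ x in Ioo a b, (p x * (y x * z x) * p x - p x * (y' x * z x + y x * z' x)) := by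
    rw [hq _ (hYZ.memW12Zero (by simp [hza]) (by simp [hzb]))]
    refine integral_congr_ae ?_
    filter_upwards [hYZ.weakDeriv_ae_eq, hYZ.ae_eq] with x hx hx'
    rw [hx, hx']
    ring
  have integrableOn_potential := ((hp.mul_continuousOn hYZ.continuousOn).integrableOn_mul hp).sub
    (hp.integrableOn_mul hYZ.memL2_deriv)
  rw [schrodingerPairing, integral_deriv_mul_deriv, potential_apply]
  refine (integral_add (hY.memL2_deriv.integrableOn_mul hZ.memL2_deriv)
    integrableOn_potential).symm.trans (integral_congr_ae (.of_forall fun x => ?_))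
  simp only [Pi.sub_apply]
  ring

theorem schrodingerEq (hab : a < b) (hf : HasLogDeriv a b f p) (hq : IsRiccatiPotential a b q p)
    (hY : HasACRepr a b Y y y') (hg : MemL2 a b g)
    (hB : IsPrimitive a b B (fun x => -(f x * g x)))
    (hBy : (fun x => f x * (y' x - p x * y x)) =ᵐ[volume.restrict (Ioo a b)] B) :
    SchrodingerEq a b q Y g := by
  refine ⟨hg, fun φ hφ => ?_⟩
  obtain ⟨v, hv, hva, hvb⟩ := hφ.exists_hasACRepr hab
  have by_parts := hB.integral_deriv_mul_add_integral_mul_deriv (hf.div hv).isPrimitive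
  simp only [hva, hvb, zero_div, mul_zero, sub_zero] at by_parts
  calc schrodingerPairing a b q Y φ
      = ∫ x in Ioo a b, (y' x - p x * y x) * (weakDeriv a b φ x - p x * v x) :=
        hq.schrodingerPairing_eq hf.memL2 hY hv hva hvb
    _ = ∫ x in Ioo a b, B x * ((weakDeriv a b φ x - p x * v x) / f x) := by
        refine integral_congr_ae ?_
        filter_upwards [hBy, hf.ae_ne_zero] with x hx hfx
        rw [← hx]
        field_simp
    _ = -∫ x in Ioo a b, -(f x * g x) * (v x / f x) := eq_neg_of_add_eq_zero_right by_parts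
    _ = ∫ x in Ioo a b, g x * φ x := by
        rw [← integral_neg]
        refine integral_congr_ae ?_
        filter_upwards [hv.ae_eq, hf.ae_ne_zero] with x hx hfx
        rw [hx]
        field_simp

theorem exists_isPrimitive_of_schrodingerEq (hab : a < b) (hf : HasLogDeriv a b f p)
    (hq : IsRiccatiPotential a b q p) (hY : HasACRepr a b Y y y') (hYg : SchrodingerEq a b q Y g) :
    ∃ B, IsPrimitive a b B (fun x => -(f x * g x)) ∧
      (fun x => f x * (y' x - p x * y x)) =ᵐ[volume.restrict (Ioo a b)] B := by
  have memL2_derivative : MemL2 a b (fun x => -(f x * g x)) :=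
    (hYg.1.continuousOn_mul hf.continuousOn).neg
  have memL2_function : MemL2 a b (fun x => f x * (y' x - p x * y x)) :=
    (hY.memL2_deriv.sub (hf.memL2.mul_continuousOn hY.continuousOn)).continuousOn_mul
      hf.continuousOn
  refine HasWeakDeriv.exists_isPrimitive hab ⟨memL2_function.integrableOn.locallyIntegrableOn,
    memL2_derivative.integrableOn.locallyIntegrableOn, fun η hη => ?_⟩
    memL2_derivative.integrableOn
  have hη_repr : HasACRepr a b η η (deriv η) := (hη.isPrimitive hab.le).hasACRepr
    (memL2_of_continuousOn hη.deriv.1.continuous.continuousOn)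
  have hfη := hf.hasACRepr.mul hη_repr
  have hfη_left : f a * η a = 0 := by rw [hη.apply_of_notMem left_notMem_Ioo, mul_zero]
  have hfη_right : f b * η b = 0 := by rw [hη.apply_of_notMem right_notMem_Ioo, mul_zero]
  calc ∫ x in Ioo a b, f x * (y' x - p x * y x) * deriv η x
      = ∫ x in Ioo a b, (y' x - p x * y x)
          * (p x * f x * η x + f x * deriv η x - p x * (f x * η x)) :=
        integral_congr_ae (.of_forall fun x => by ring)
    _ = schrodingerPairing a b q Y (fun x => f x * η x) :=
        (hq.schrodingerPairing_eq hf.memL2 hY hfη hfη_left hfη_right).symm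
    _ = ∫ x in Ioo a b, g x * (f x * η x) := hYg.2 _ (hfη.memW12Zero hfη_left hfη_right)
    _ = -∫ x in Ioo a b, -(f x * g x) * η x := by
        rw [← integral_neg]
        exact integral_congr_ae (.of_forall fun x => by ring)

end IsRiccatiPotential

end Riccati

/-! ### Exponential solutions -/

section FirstOrderSystem

variable {a b : ℝ} {m n A B A₁ B₁ : ℝ → ℂ}

theorem IsPrimitive.hasDerivWithinAt {u g : ℝ → ℂ} (hu : IsPrimitive a b u g)
    (hg : ContinuousOn g (Icc a b)) {t : ℝ} (ht : t ∈ Ico a b) :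
    HasDerivWithinAt u (g t) (Ici t) t := by
  have nhds_right : Icc a b ∈ 𝓝[>] t := Icc_mem_nhdsGT_of_mem ht
  have stronglyMeasurableAt : StronglyMeasurableAtFilter g (𝓝[>] t) volume :=
    ⟨Icc a b, nhds_right, hg.aestronglyMeasurable measurableSet_Icc⟩
  have continuousWithinAt : ContinuousWithinAt g (Ioi t) t :=
    (hg t (Ico_subset_Icc_self ht)).mono_of_mem_nhdsWithin nhds_right
  refine ((intervalIntegral.integral_hasDerivWithinAt_right
    (intervalIntegrable_of_mem_Icc hu.intervalIntegrable hu.left_mem (Ico_subset_Icc_self ht))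
    stronglyMeasurableAt continuousWithinAt).const_add (u a)).congr_of_eventuallyEq ?_
    (hu.eq_add_integral t (Ico_subset_Icc_self ht))
  filter_upwards [Icc_mem_nhdsGE_of_mem ht] with x hx using hu.eq_add_integral x hx

/-- `(A, B)` is an absolutely continuous solution of the system `A' = m B`, `B' = n A`
on `[a,b]`. -/
structure IsOffDiagSolution (a b : ℝ) (m n A B : ℝ → ℂ) : Prop where
  fst : IsPrimitive a b A (fun x => m x * B x)
  snd : IsPrimitive a b B (fun x => n x * A x)

theorem lipschitzWith_offDiag {c d : ℂ} {K : NNReal} (hc : ‖c‖ ≤ K) (hd : ‖d‖ ≤ K) :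
    LipschitzWith K fun z : ℂ × ℂ => (c * z.2, d * z.1) := by
  refine LipschitzWith.of_dist_le_mul fun z w => ?_
  simp only [Prod.dist_eq, Complex.dist_eq, ← mul_sub, norm_mul]
  exact max_le (mul_le_mul hc (le_max_right _ _) (norm_nonneg _) K.2)
    (mul_le_mul hd (le_max_left _ _) (norm_nonneg _) K.2)

theorem IsOffDiagSolution.eqOn (hm : ContinuousOn m (Icc a b)) (hn : ContinuousOn n (Icc a b))
    (h : IsOffDiagSolution a b m n A B) (h₁ : IsOffDiagSolution a b m n A₁ B₁)
    (hA : A a = A₁ a) (hB : B a = B₁ a) : EqOn A A₁ (Icc a b) ∧ EqOn B B₁ (Icc a b) := by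
  obtain ⟨C, hC⟩ := isCompact_Icc.exists_bound_of_continuousOn hm
  obtain ⟨D, hD⟩ := isCompact_Icc.exists_bound_of_continuousOn hn
  have lipschitz : ∀ t ∈ Ico a b, LipschitzOnWith (max C D).toNNReal
      (fun z : ℂ × ℂ => (m t * z.2, n t * z.1)) univ := fun t ht =>
    (lipschitzWith_offDiag
      (((hC t (Ico_subset_Icc_self ht)).trans (le_max_left _ _)).trans (Real.le_coe_toNNReal _))
      (((hD t (Ico_subset_Icc_self ht)).trans (le_max_right _ _)).trans
        (Real.le_coe_toNNReal _))).lipschitzOnWith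
  have hasDerivWithinAt : ∀ {A B : ℝ → ℂ}, IsOffDiagSolution a b m n A B → ∀ t ∈ Ico a b,
      HasDerivWithinAt (fun t => (A t, B t)) (m t * B t, n t * A t) (Ici t) t := fun h t ht =>
    (h.fst.hasDerivWithinAt (hm.mul h.snd.continuousOn) ht).prodMk
      (h.snd.hasDerivWithinAt (hn.mul h.fst.continuousOn) ht)
  have eqOn := ODE_solution_unique_of_mem_Icc_right lipschitz
    (h.fst.continuousOn.prodMk h.snd.continuousOn) (hasDerivWithinAt h) (fun _ _ => mem_univ _)
    (h₁.fst.continuousOn.prodMk h₁.snd.continuousOn) (hasDerivWithinAt h₁) (fun _ _ => mem_univ _)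
    (Prod.ext hA hB)
  exact ⟨fun x hx => congrArg Prod.fst (eqOn hx), fun x hx => congrArg Prod.snd (eqOn hx)⟩

end FirstOrderSystem

namespace IsExpSolution

variable {ℓ : ℝ} {f p e e₁ : ℝ → ℂ} {q q₁ : (ℝ → ℂ) → ℂ} {ρ : ℂ}

theorem exists_isOffDiagSolution (hℓ : 0 < ℓ) (hf : HasLogDeriv 0 ℓ f p)
    (hq : IsRiccatiPotential 0 ℓ q p) (he : IsExpSolution ℓ q f ρ e) :
    ∃ B, IsOffDiagSolution 0 ℓ (fun x => (f x ^ 2)⁻¹) (fun x => -(ρ ^ 2 * f x ^ 2))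
      (fun x => e x / f x) B ∧ B 0 = f 0 * (Complex.I * ρ) := by
  have he_repr := he.mem_domain.1.hasACRepr hℓ he.continuousOn (ae_eq_refl _)
  obtain ⟨B, hB, hBe⟩ := hq.exists_isPrimitive_of_schrodingerEq hℓ hf he_repr he.eq
  refine ⟨B, ⟨(hf.div he_repr).isPrimitive.congr (fun _ _ => rfl) ?_,
    hB.congr (fun _ _ => rfl) ?_⟩, ?_⟩
  · filter_upwards [hBe, hf.ae_ne_zero] with x hx hfx
    rw [← hx]
    field_simp
  · filter_upwards [hf.ae_ne_zero] with x hfx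
    field_simp
  · obtain ⟨v, hv, opD_ae_eq, hv0⟩ := he.init_deriv
    have B_ae_eq : B =ᵐ[volume.restrict (Icc 0 ℓ)] fun x => f x * v x := by
      rw [← restrict_Ioo_eq_restrict_Icc]
      filter_upwards [hBe, opD_ae_eq, hf.opD_ae_eq he_repr] with x hBx hvx hDx
      rw [← hBx, ← hvx, hDx]
    rw [Measure.eqOn_Icc_of_ae_eq volume hℓ.ne B_ae_eq hB.continuousOn (hf.continuousOn.mul hv)
      hB.left_mem]
    exact congrArg (f 0 * ·) hv0

/-- This is `D_f e_f(ρ,·) = iρ e_{1/f}(ρ,·)`. -/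
theorem isPrimitive_div (hℓ : 0 < ℓ) (hf : HasLogDeriv 0 ℓ f p) (hf0 : f 0 = 1)
    (hq : IsRiccatiPotential 0 ℓ q p) (hq₁ : IsRiccatiPotential 0 ℓ q₁ (-p))
    (he : IsExpSolution ℓ q f ρ e) (he₁ : IsExpSolution ℓ q₁ f⁻¹ ρ e₁) :
    IsPrimitive 0 ℓ (fun x => e x / f x) (fun x => Complex.I * ρ * e₁ x / f x) := by
  obtain ⟨B, hAB, hB0⟩ := he.exists_isOffDiagSolution hℓ hf hq
  obtain ⟨B₁, hAB₁, hB₁0⟩ := he₁.exists_isOffDiagSolution hℓ hf.inv hq₁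
  have integrable : IntervalIntegrable (fun x => Complex.I * ρ * e₁ x / f x) volume 0 ℓ :=
    ((continuousOn_const.mul he₁.continuousOn).div hf.continuousOn
      hf.ne_zero).intervalIntegrable_of_Icc hℓ.le
  -- Both `(e / f, f D_f e)` and `(A, iρ f e₁)` solve the system of `exists_isOffDiagSolution`.
  set A : ℝ → ℂ := fun x => 1 + ∫ t in 0..x, Complex.I * ρ * e₁ t / f t with hA
  have isPrimitive_A : IsPrimitive 0 ℓ A (fun x => Complex.I * ρ * e₁ x / f x) :=
    .const_add_integral hℓ.le integrable 1
  have B₁_eq : EqOn B₁ (fun x => Complex.I * ρ * A x) (Icc 0 ℓ) := by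
    refine hAB₁.snd.eqOn ((isPrimitive_A.const_mul (Complex.I * ρ)).congr (fun _ _ => rfl) ?_) ?_
    · filter_upwards [hf.ae_ne_zero] with x hfx
      simp only [Pi.inv_apply]
      field_simp
      rw [Complex.I_sq]
      ring
    · simp [hB₁0, hA, hf0]
  have solution : IsOffDiagSolution 0 ℓ (fun x => (f x ^ 2)⁻¹) (fun x => -(ρ ^ 2 * f x ^ 2))
      A (fun x => Complex.I * ρ * (e₁ x / f⁻¹ x)) := by
    refine ⟨isPrimitive_A.congr (fun _ _ => rfl) ?_,
      (hAB₁.fst.const_mul (Complex.I * ρ)).congr (fun _ _ => rfl) ?_⟩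
    · filter_upwards [hf.ae_ne_zero] with x hfx
      simp only [Pi.inv_apply]
      field_simp
    · filter_upwards [ae_restrict_mem measurableSet_Ioo] with x hx
      rw [B₁_eq (Ioo_subset_Icc_self hx)]
      simp only [Pi.inv_apply, inv_pow, inv_inv]
      linear_combination ρ ^ 2 * f x ^ 2 * A x * Complex.I_sq
  have eqOn := hAB.eqOn ((hf.continuousOn.pow 2).inv₀ fun x hx => pow_ne_zero 2 (hf.ne_zero x hx))
    (continuousOn_const.mul (hf.continuousOn.pow 2)).neg solution
    (by simp [hA, he.init, hf0]) (by simp [hB0, he₁.init, hf0])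
  exact isPrimitive_A.congr eqOn.1 (ae_eq_refl _)

end IsExpSolution

/-! ### A Volterra equation -/

section Volterra

variable {p : ℝ → ℂ} {κ κ₀ : ℝ → ℝ → ℂ} {w C D : ℝ}

/-- The Volterra operator `κ ↦ ∫_r^x p(τ) κ(τ, τ - r) dτ` on kernels. The two kernels of the
Dirac system are transformed into each other by it. -/
noncomputable def volterraShift (p : ℝ → ℂ) (κ : ℝ → ℝ → ℂ) (x r : ℝ) : ℂ :=
  ∫ τ in Ioo r x, p τ * κ τ (τ - r)

theorem volterraShift_neg_left : volterraShift (-p) κ = -volterraShift p κ := by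
  ext x r
  simp only [volterraShift, Pi.neg_apply, neg_mul, integral_neg]

theorem stronglyMeasurable_volterraShift (hp : StronglyMeasurable p)
    (hκ : StronglyMeasurable (Function.uncurry κ)) :
    StronglyMeasurable (Function.uncurry (volterraShift p κ)) := by
  have region : MeasurableSet {z : (ℝ × ℝ) × ℝ | z.1.2 < z.2 ∧ z.2 < z.1.1} :=
    (measurableSet_lt (measurable_snd.comp measurable_fst) measurable_snd).inter
      (measurableSet_lt measurable_snd (measurable_fst.comp measurable_fst))
  have integrand : StronglyMeasurable fun z : (ℝ × ℝ) × ℝ => p z.2 * κ z.2 (z.2 - z.1.2) :=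
    (hp.comp_measurable measurable_snd).mul
      (hκ.comp_measurable (g := fun z : (ℝ × ℝ) × ℝ => (z.2, z.2 - z.1.2)) (by fun_prop))
  convert (integrand.indicator region).integral_prod_right' (ν := (volume : Measure ℝ)) using 1
  ext ⟨x, r⟩
  rw [Function.uncurry_apply_pair, volterraShift, ← integral_indicator measurableSet_Ioo]
  rfl

/-- With the weight `exp (w x)`, integration of `‖p‖` over left half-lines is a contraction with
factor `1 / 2`. -/
structure IsVolterraWeight (p : ℝ → ℂ) (w : ℝ) : Prop where
  pos : 0 < w
  integrableOn : ∀ x, IntegrableOn (fun τ => ‖p τ‖ * Real.exp (w * τ)) (Iio x)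
  integral_le : ∀ x, ∫ τ in Iio x, ‖p τ‖ * Real.exp (w * τ) ≤ Real.exp (w * x) / 2

theorem IsVolterraWeight.neg (hw : IsVolterraWeight p w) : IsVolterraWeight (-p) w where
  pos := hw.pos
  integrableOn := by simpa only [Pi.neg_apply, norm_neg] using hw.integrableOn
  integral_le := by simpa only [Pi.neg_apply, norm_neg] using hw.integral_le

theorem mul_exp_le_weighted_sq_add_sq (hw : 0 < w) (s τ x : ℝ) :
    s * Real.exp (w * τ) ≤ Real.exp (w * x) / (2 * w) * s ^ 2
      + w / (2 * Real.exp (w * x)) * Real.exp (2 * w * τ) := by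
  have exp_sq : Real.exp (2 * w * τ) = Real.exp (w * τ) ^ 2 := by
    rw [← Real.exp_nat_mul]
    push_cast
    ring_nf
  rw [← sub_nonneg, exp_sq]
  calc 0 ≤ (Real.exp (w * x) * s - w * Real.exp (w * τ)) ^ 2 / (2 * w * Real.exp (w * x)) := by
        positivity
    _ = _ := by
        field_simp
        ring

theorem exists_isVolterraWeight (hp : MemLp p 2) : ∃ w, IsVolterraWeight p w := by
  have sq_integrable : Integrable fun τ => ‖p τ‖ ^ 2 := hp.integrable_norm_pow two_ne_zero
  set P := ∫ τ, ‖p τ‖ ^ 2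
  have hP : 0 ≤ P := integral_nonneg fun τ => by positivity
  obtain ⟨w, hw⟩ : ∃ w, w = 2 * (P + 1) := ⟨_, rfl⟩
  have w_pos : 0 < w := by linarith
  have majorant (x : ℝ) : IntegrableOn (fun τ => Real.exp (w * x) / (2 * w) * ‖p τ‖ ^ 2
      + w / (2 * Real.exp (w * x)) * Real.exp (2 * w * τ)) (Iio x) :=
    (sq_integrable.const_mul _).integrableOn.add
      (((integrableOn_exp_mul_Iic (by positivity) x).mono_set Iio_subset_Iic_self).const_mul _)
  have integrableOn (x : ℝ) : IntegrableOn (fun τ => ‖p τ‖ * Real.exp (w * τ)) (Iio x) :=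
    (majorant x).mono' (hp.1.norm.mul (by fun_prop)).restrict (.of_forall fun τ => by
      rw [norm_mul, norm_norm, Real.norm_eq_abs, Real.abs_exp]
      exact mul_exp_le_weighted_sq_add_sq w_pos _ τ x)
  refine ⟨w, w_pos, integrableOn, fun x => ?_⟩
  calc ∫ τ in Iio x, ‖p τ‖ * Real.exp (w * τ)
      ≤ ∫ τ in Iio x, (Real.exp (w * x) / (2 * w) * ‖p τ‖ ^ 2
          + w / (2 * Real.exp (w * x)) * Real.exp (2 * w * τ)) :=
        setIntegral_mono (integrableOn x) (majorant x) fun τ =>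
          mul_exp_le_weighted_sq_add_sq w_pos _ τ x
    _ = Real.exp (w * x) / (2 * w) * (∫ τ in Iio x, ‖p τ‖ ^ 2)
          + w / (2 * Real.exp (w * x)) * (Real.exp (2 * w * x) / (2 * w)) := by
        rw [integral_add (sq_integrable.const_mul _).integrableOn
          (((integrableOn_exp_mul_Iic (by positivity) x).mono_set Iio_subset_Iic_self).const_mul _),
          integral_const_mul, integral_const_mul, ← integral_Iic_eq_integral_Iio (f :=
            fun τ => Real.exp (2 * w * τ)), integral_exp_mul_Iic (by positivity)]
    _ ≤ Real.exp (w * x) / (2 * w) * P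
          + w / (2 * Real.exp (w * x)) * (Real.exp (2 * w * x) / (2 * w)) := by
        gcongr
        exact setIntegral_le_integral sq_integrable (.of_forall fun τ => by positivity)
    _ = Real.exp (w * x) / 2 * (P / w + 1 / 2) := by
        rw [show 2 * w * x = w * x + w * x by ring, Real.exp_add]
        field_simp
    _ ≤ Real.exp (w * x) / 2 * 1 := by
        gcongr
        rw [← le_sub_iff_add_le, div_le_iff₀ w_pos, hw]
        linarith
    _ = Real.exp (w * x) / 2 := mul_one _

/-- `κ` is a measurable kernel with `|κ(x,r)| ≤ C exp (w x)`. -/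
structure HasExpGrowth (w C : ℝ) (κ : ℝ → ℝ → ℂ) : Prop where
  stronglyMeasurable : StronglyMeasurable (Function.uncurry κ)
  norm_le : ∀ x r, ‖κ x r‖ ≤ C * Real.exp (w * x)

namespace HasExpGrowth

theorem nonneg (hκ : HasExpGrowth w C κ) : 0 ≤ C := by
  simpa using (norm_nonneg _).trans (hκ.norm_le 0 0)

theorem norm_mul_le (hκ : HasExpGrowth w C κ) (z : ℂ) (x r : ℝ) :
    ‖z * κ x r‖ ≤ C * (‖z‖ * Real.exp (w * x)) :=
  calc ‖z * κ x r‖ = ‖z‖ * ‖κ x r‖ := norm_mul _ _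
    _ ≤ ‖z‖ * (C * Real.exp (w * x)) := by gcongr; exact hκ.norm_le x r
    _ = C * (‖z‖ * Real.exp (w * x)) := by ring

theorem integrableOn (hκ : HasExpGrowth w C κ) (hp : StronglyMeasurable p)
    (hw : IsVolterraWeight p w) (x r : ℝ) :
    IntegrableOn (fun τ => p τ * κ τ (τ - r)) (Ioo r x) :=
  (((hw.integrableOn x).mono_set Ioo_subset_Iio_self).const_mul C).mono'
    (hp.mul (hκ.stronglyMeasurable.comp_measurable (g := fun τ : ℝ => (τ, τ - r))
      (by fun_prop))).aestronglyMeasurable (.of_forall fun τ => hκ.norm_mul_le _ _ _)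

theorem integral_norm_le (hκ : HasExpGrowth w C κ) (hp : StronglyMeasurable p)
    (hw : IsVolterraWeight p w) (x r : ℝ) :
    ∫ τ in Ioo r x, ‖p τ * κ τ (τ - r)‖ ≤ C / 2 * Real.exp (w * x) := by
  have hC := hκ.nonneg
  calc ∫ τ in Ioo r x, ‖p τ * κ τ (τ - r)‖
      ≤ ∫ τ in Ioo r x, C * (‖p τ‖ * Real.exp (w * τ)) :=
        setIntegral_mono (hκ.integrableOn hp hw x r).norm
          (((hw.integrableOn x).mono_set Ioo_subset_Iio_self).const_mul C)
          fun τ => hκ.norm_mul_le _ _ _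
    _ ≤ ∫ τ in Iio x, C * (‖p τ‖ * Real.exp (w * τ)) :=
        setIntegral_mono_set ((hw.integrableOn x).const_mul C)
          (.of_forall fun τ => by positivity) Ioo_subset_Iio_self.eventuallyLE
    _ = C * ∫ τ in Iio x, ‖p τ‖ * Real.exp (w * τ) := integral_const_mul _ _
    _ ≤ C * (Real.exp (w * x) / 2) := by gcongr; exact hw.integral_le x
    _ = C / 2 * Real.exp (w * x) := by ring

theorem volterraShift (hκ : HasExpGrowth w C κ) (hp : StronglyMeasurable p)
    (hw : IsVolterraWeight p w) : HasExpGrowth w (C / 2) (volterraShift p κ) where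
  stronglyMeasurable := stronglyMeasurable_volterraShift hp hκ.stronglyMeasurable
  norm_le x r := (norm_integral_le_integral_norm _).trans (hκ.integral_norm_le hp hw x r)

theorem iterate_volterraShift (hκ : HasExpGrowth w C κ) (hp : StronglyMeasurable p)
    (hw : IsVolterraWeight p w) (n : ℕ) :
    HasExpGrowth w (C / 2 ^ n) ((DistSchrodinger.volterraShift p)^[n] κ) := by
  induction n with
  | zero => simpa using hκ
  | succ n ih =>
    rw [Function.iterate_succ_apply', pow_succ, ← div_div]
    exact ih.volterraShift hp hw

section Series

variable {κs : ℕ → ℝ → ℝ → ℂ} {Cs : ℕ → ℝ}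

theorem summable (hκ : ∀ n, HasExpGrowth w (Cs n) (κs n)) (hC : Summable Cs) (x r : ℝ) :
    Summable fun n => κs n x r :=
  .of_norm_bounded (hC.mul_right (Real.exp (w * x))) fun n => (hκ n).norm_le x r

theorem tsum (hκ : ∀ n, HasExpGrowth w (Cs n) (κs n)) (hC : Summable Cs) :
    HasExpGrowth w (∑' n, Cs n) fun x r => ∑' n, κs n x r where
  stronglyMeasurable :=
    (Measurable.tsum fun n => (hκ n).stronglyMeasurable.measurable).stronglyMeasurable
  norm_le x r := tsum_of_norm_bounded (hC.hasSum.mul_right _) fun n => (hκ n).norm_le x r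

theorem volterraShift_tsum (hp : StronglyMeasurable p) (hw : IsVolterraWeight p w)
    (hκ : ∀ n, HasExpGrowth w (Cs n) (κs n)) (hC : Summable Cs) (x r : ℝ) :
    DistSchrodinger.volterraShift p (fun τ σ => ∑' n, κs n τ σ) x r
      = ∑' n, DistSchrodinger.volterraShift p (κs n) x r := by
  have norm_summable : Summable fun n => ∫ τ in Ioo r x, ‖p τ * κs n τ (τ - r)‖ :=
    .of_nonneg_of_le (fun n => integral_nonneg fun τ => norm_nonneg _)
      (fun n => (hκ n).integral_norm_le hp hw x r) ((hC.div_const 2).mul_right _)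
  simpa only [tsum_mul_left] using! (hasSum_integral_of_summable_integral_norm
    (fun n => (hκ n).integrableOn hp hw x r) norm_summable).tsum_eq.symm

end Series

/-- The Neumann series of `1 - V`, where `V` is `volterraShift p`. -/
theorem exists_eq_add_volterraShift (hκ₀ : HasExpGrowth w C κ₀) (hp : StronglyMeasurable p)
    (hw : IsVolterraWeight p w) :
    ∃ κ, HasExpGrowth w (2 * C) κ ∧ κ = κ₀ + DistSchrodinger.volterraShift p κ := by
  have growth := hκ₀.iterate_volterraShift hp hw
  have coeff_eq (n : ℕ) : C / 2 ^ n = 2 * C / 2 / 2 ^ n := by ring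
  simp only [coeff_eq] at growth
  have coeff_hasSum : HasSum (fun n : ℕ => 2 * C / 2 / 2 ^ n) (2 * C) := hasSum_geometric_two' _
  refine ⟨_, coeff_hasSum.tsum_eq ▸ tsum growth coeff_hasSum.summable, ?_⟩
  ext x r
  rw [Pi.add_apply, Pi.add_apply, volterraShift_tsum hp hw growth coeff_hasSum.summable,
    (summable growth coeff_hasSum.summable x r).tsum_eq_zero_add]
  simp only [Function.iterate_zero_apply, Function.iterate_succ_apply']

theorem add (hκ : HasExpGrowth w C κ) (hκ₀ : HasExpGrowth w D κ₀) :
    HasExpGrowth w (C + D) (κ + κ₀) where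
  stronglyMeasurable := hκ.stronglyMeasurable.add hκ₀.stronglyMeasurable
  norm_le x r :=
    (norm_add_le_of_le (hκ.norm_le x r) (hκ₀.norm_le x r)).trans_eq (add_mul _ _ _).symm

theorem const_smul (hκ : HasExpGrowth w C κ) (c : ℂ) : HasExpGrowth w (‖c‖ * C) (c • κ) where
  stronglyMeasurable := hκ.stronglyMeasurable.const_smul c
  norm_le x r := by
    rw [Pi.smul_apply, Pi.smul_apply, norm_smul, mul_assoc]
    gcongr
    exact hκ.norm_le x r

theorem volterraShift_add (hp : StronglyMeasurable p) (hw : IsVolterraWeight p w)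
    (hκ : HasExpGrowth w C κ) (hκ₀ : HasExpGrowth w D κ₀) :
    DistSchrodinger.volterraShift p (κ + κ₀)
      = DistSchrodinger.volterraShift p κ + DistSchrodinger.volterraShift p κ₀ := by
  ext x r
  simp only [DistSchrodinger.volterraShift, Pi.add_apply, mul_add]
  exact integral_add (hκ.integrableOn hp hw x r) (hκ₀.integrableOn hp hw x r)

end HasExpGrowth

theorem volterraShift_const_smul (c : ℂ) : volterraShift p (c • κ) = c • volterraShift p κ := by
  ext x r
  simp only [volterraShift, Pi.smul_apply, smul_eq_mul, mul_left_comm, integral_const_mul]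

end Volterra

/-- A measurable square integrable function on `ℝ` vanishing off `(0,ℓ)`. -/
structure IsSupportedL2 (ℓ : ℝ) (p : ℝ → ℂ) : Prop where
  stronglyMeasurable : StronglyMeasurable p
  memLp : MemLp p 2
  eq_zero : ∀ x, x ∉ Ioo 0 ℓ → p x = 0

/-- `α` and `γ` are the kernels of the Dirac system `y' = p y + iρz`, `z' = -p z + iρy` with
potential `p`: they solve `α = V (2 p + γ)`, `γ = V α`, where `V` is `volterraShift p` and `p` is
regarded as a kernel depending on the second variable only. -/
structure IsDiracKernel (p : ℝ → ℂ) (w C : ℝ) (α γ : ℝ → ℝ → ℂ) : Prop where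
  weight : IsVolterraWeight p w
  growth_fst : HasExpGrowth w C α
  growth_snd : HasExpGrowth w C γ
  fst_eq : α = volterraShift p fun τ σ => 2 * p σ + γ τ σ
  snd_eq : γ = volterraShift p α

namespace IsSupportedL2

variable {ℓ w : ℝ} {p : ℝ → ℂ}

theorem integrable_sq (hp : IsSupportedL2 ℓ p) : Integrable fun x => ‖p x‖ ^ 2 :=
  hp.memLp.integrable_norm_pow two_ne_zero

theorem hasExpGrowth_volterraShift (hp : IsSupportedL2 ℓ p) (hw : 0 ≤ w) :
    HasExpGrowth w (2 * ∫ τ, ‖p τ‖ ^ 2) (volterraShift p fun _ σ => 2 * p σ) where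
  stronglyMeasurable := stronglyMeasurable_volterraShift hp.stronglyMeasurable
    ((hp.stronglyMeasurable.comp_measurable measurable_snd).const_mul 2)
  norm_le x r := by
    rcases le_or_gt x 0 with hx | hx
    · have eq_zero : volterraShift p (fun _ σ => 2 * p σ) x r = 0 :=
        setIntegral_eq_zero_of_forall_eq_zero fun τ hτ => by
          rw [hp.eq_zero τ fun h => (hτ.2.trans_le hx).not_gt h.1, zero_mul]
      rw [eq_zero, norm_zero]
      positivity
    · have majorant : Integrable fun τ => ‖p τ‖ ^ 2 + ‖p (τ - r)‖ ^ 2 :=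
        hp.integrable_sq.add (hp.integrable_sq.comp_sub_right r)
      have norm_integrand_le (τ : ℝ) : ‖p τ * (2 * p (τ - r))‖ ≤ ‖p τ‖ ^ 2 + ‖p (τ - r)‖ ^ 2 := by
        rw [norm_mul, norm_mul, Complex.norm_two]
        linarith [two_mul_le_add_sq ‖p τ‖ ‖p (τ - r)‖]
      calc ‖volterraShift p (fun _ σ => 2 * p σ) x r‖
          ≤ ∫ τ in Ioo r x, (‖p τ‖ ^ 2 + ‖p (τ - r)‖ ^ 2) :=
            norm_integral_le_of_norm_le majorant.integrableOn (.of_forall norm_integrand_le)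
        _ ≤ ∫ τ, (‖p τ‖ ^ 2 + ‖p (τ - r)‖ ^ 2) :=
            setIntegral_le_integral majorant (.of_forall fun τ => by positivity)
        _ = 2 * ∫ τ, ‖p τ‖ ^ 2 := by
            rw [integral_add hp.integrable_sq (hp.integrable_sq.comp_sub_right r),
              integral_sub_right_eq_self (fun σ => ‖p σ‖ ^ 2) r, two_mul]
        _ ≤ (2 * ∫ τ, ‖p τ‖ ^ 2) * Real.exp (w * x) :=
            le_mul_of_one_le_right (by positivity) (Real.one_le_exp (by positivity))

theorem integrableOn_mul_comp_sub (hp : IsSupportedL2 ℓ p) (x r : ℝ) :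
    IntegrableOn (fun τ => p τ * (2 * p (τ - r))) (Ioo r x) :=
  (hp.memLp.integrable_mul ((hp.memLp.comp_measurePreserving
    (measurePreserving_sub_right volume r)).const_mul 2)).integrableOn

theorem exists_isDiracKernel (hp : IsSupportedL2 ℓ p) :
    ∃ w C α γ, IsDiracKernel p w C α γ := by
  obtain ⟨w, hw⟩ := exists_isVolterraWeight hp.memLp
  have hκ₀ := hp.hasExpGrowth_volterraShift hw.pos.le
  -- `α + γ` and `α - γ` satisfy uncoupled equations, with potentials `p` and `-p`.
  obtain ⟨σ, hσ, σ_eq⟩ := hκ₀.exists_eq_add_volterraShift hp.stronglyMeasurable hw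
  obtain ⟨δ, hδ, δ_eq⟩ := hκ₀.exists_eq_add_volterraShift hp.stronglyMeasurable.neg hw.neg
  rw [volterraShift_neg_left] at δ_eq
  have hδ_neg := hδ.const_smul (-1)
  rw [norm_neg, norm_one, one_mul] at hδ_neg
  have hα := (hσ.add hδ).const_smul (1 / 2)
  have hγ := (hσ.add hδ_neg).const_smul (1 / 2)
  refine ⟨w, _, _, _, hw, hα, hγ, ?_, ?_⟩
  · have split : volterraShift p (fun τ σ' => 2 * p σ' + ((1 / 2 : ℂ) • (σ + (-1 : ℂ) • δ)) τ σ')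
        = volterraShift p (fun _ σ => 2 * p σ)
          + volterraShift p ((1 / 2 : ℂ) • (σ + (-1 : ℂ) • δ)) := by
      ext x r
      simp only [volterraShift, mul_add]
      exact integral_add (hp.integrableOn_mul_comp_sub x r)
        (hγ.integrableOn hp.stronglyMeasurable hw x r)
    rw [split, volterraShift_const_smul, hσ.volterraShift_add hp.stronglyMeasurable hw hδ_neg,
      volterraShift_const_smul]
    nth_rewrite 1 [σ_eq, δ_eq]
    module
  · rw [volterraShift_const_smul, hσ.volterraShift_add hp.stronglyMeasurable hw hδ]
    nth_rewrite 1 [σ_eq, δ_eq]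
    module

end IsSupportedL2

/-! ### The Dirac system -/

section Triangle

variable {G : ℝ → ℝ → ℂ} {x : ℝ}

theorem indicator_triangle_eq_fst (G : ℝ → ℝ → ℂ) (x τ r : ℝ) :
    {z : ℝ × ℝ | 0 < z.2 ∧ z.2 < z.1 ∧ z.1 < x}.indicator (Function.uncurry G) (τ, r)
      = (Ioo 0 x).indicator (fun τ => (Ioo 0 τ).indicator (G τ) r) τ := by
  simp only [indicator_apply, mem_ofPred_eq, mem_Ioo, Function.uncurry_apply_pair]
  grind

theorem indicator_triangle_eq_snd (G : ℝ → ℝ → ℂ) (x τ r : ℝ) :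
    {z : ℝ × ℝ | 0 < z.2 ∧ z.2 < z.1 ∧ z.1 < x}.indicator (Function.uncurry G) (τ, r)
      = (Ioo 0 x).indicator (fun r => (Ioo r x).indicator (fun τ => G τ r) τ) r := by
  simp only [indicator_apply, mem_ofPred_eq, mem_Ioo, Function.uncurry_apply_pair]
  grind

theorem measurableSet_lt_lt (x : ℝ) :
    MeasurableSet {z : ℝ × ℝ | 0 < z.2 ∧ z.2 < z.1 ∧ z.1 < x} :=
  (measurableSet_lt measurable_const measurable_snd).inter
    ((measurableSet_lt measurable_snd measurable_fst).inter
      (measurableSet_lt measurable_fst measurable_const))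

theorem integral_indicator_Ioo_indicator (G : ℝ → ℝ → ℂ) (s : ℝ → Set ℝ)
    (hs : ∀ τ, MeasurableSet (s τ)) (x τ : ℝ) :
    ∫ r, (Ioo 0 x).indicator (fun τ => (s τ).indicator (G τ) r) τ
      = (Ioo 0 x).indicator (fun τ => ∫ r in s τ, G τ r) τ := by
  by_cases hτ : τ ∈ Ioo 0 x
  · simp only [indicator_of_mem hτ, integral_indicator (hs τ)]
  · simp only [indicator_of_notMem hτ, integral_zero]

theorem integrableOn_setIntegral_triangle
    (hG : IntegrableOn (Function.uncurry G) {z | 0 < z.2 ∧ z.2 < z.1 ∧ z.1 < x}) :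
    IntegrableOn (fun τ => ∫ r in Ioo 0 τ, G τ r) (Ioo 0 x) := by
  rw [← integrable_indicator_iff (measurableSet_lt_lt x), Measure.volume_eq_prod] at hG
  rw [← integrable_indicator_iff measurableSet_Ioo]
  simpa only [indicator_triangle_eq_fst,
    integral_indicator_Ioo_indicator G _ fun _ => measurableSet_Ioo] using hG.integral_prod_left

theorem setIntegral_triangle_swap
    (hG : IntegrableOn (Function.uncurry G) {z | 0 < z.2 ∧ z.2 < z.1 ∧ z.1 < x}) :
    ∫ r in Ioo 0 x, ∫ τ in Ioo r x, G τ r = ∫ τ in Ioo 0 x, ∫ r in Ioo 0 τ, G τ r := by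
  rw [← integrable_indicator_iff (measurableSet_lt_lt x), Measure.volume_eq_prod] at hG
  set F := {z : ℝ × ℝ | 0 < z.2 ∧ z.2 < z.1 ∧ z.1 < x}.indicator (Function.uncurry G) with hF
  calc ∫ r in Ioo 0 x, ∫ τ in Ioo r x, G τ r = ∫ r, ∫ τ, F (τ, r) := by
        simp only [hF, indicator_triangle_eq_snd, integral_indicator_Ioo_indicator
          (fun r τ => G τ r) _ fun _ => measurableSet_Ioo, integral_indicator measurableSet_Ioo]
    _ = ∫ τ, ∫ r, F (τ, r) := (integral_integral_swap (f := fun τ r => F (τ, r)) hG).symm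
    _ = ∫ τ in Ioo 0 x, ∫ r in Ioo 0 τ, G τ r := by
        simp only [hF, indicator_triangle_eq_fst, integral_indicator_Ioo_indicator G _
          fun _ => measurableSet_Ioo, integral_indicator measurableSet_Ioo]

end Triangle

section Fubini

variable {ℓ : ℝ} {p : ℝ → ℂ} {k : ℝ → ℝ} {κ : ℝ → ℝ → ℂ}

theorem integrableOn_triangle_shear (hp : Integrable p)
    (hκ : StronglyMeasurable (Function.uncurry κ)) (hk : IntegrableOn k (Ioo 0 ℓ))
    (hκk : ∀ τ ∈ Ioo 0 ℓ, ∀ σ ∈ Ioo 0 ℓ, ‖κ τ σ‖ ≤ k σ) (c : ℂ) :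
    IntegrableOn (Function.uncurry fun τ r : ℝ => p τ * κ τ (τ - r) * Complex.exp (c * r))
      {z | 0 < z.2 ∧ z.2 < z.1 ∧ z.1 < ℓ} := by
  set k' := (Ioo 0 ℓ).indicator k with hk'
  have majorant : Integrable fun z : ℝ × ℝ => ‖p z.1‖ * k' (z.1 - z.2) := by
    simpa [Function.comp_def, Measure.volume_eq_prod] using
      (hp.norm.convolution_integrand (ContinuousLinearMap.mul ℝ ℝ)
        ((integrable_indicator_iff measurableSet_Ioo).2 hk).comp_neg).swap
  have measurable : AEStronglyMeasurable
      (Function.uncurry fun τ r : ℝ => p τ * κ τ (τ - r) * Complex.exp (c * r)) :=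
    (hp.aestronglyMeasurable.comp_fst.mul (hκ.comp_measurable
      (g := fun z : ℝ × ℝ => (z.1, z.1 - z.2)) (by fun_prop)).aestronglyMeasurable).mul
      (Continuous.aestronglyMeasurable (by fun_prop))
  refine (majorant.mul_const (Real.exp (‖c‖ * ℓ))).integrableOn.mono' measurable.restrict
    ((ae_restrict_iff' (measurableSet_lt_lt ℓ)).2 (.of_forall fun ⟨τ, r⟩ ⟨hr, hrτ, hτ⟩ => ?_))
  simp only at hr hrτ hτ
  have shift_mem : τ - r ∈ Ioo 0 ℓ := ⟨by linarith, by linarith⟩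
  have kernel_le : ‖κ τ (τ - r)‖ ≤ k' (τ - r) := by
    rw [hk', indicator_of_mem shift_mem]
    exact hκk τ ⟨by linarith, hτ⟩ _ shift_mem
  have exp_le : ‖Complex.exp (c * r)‖ ≤ Real.exp (‖c‖ * ℓ) := by
    refine (Complex.norm_exp_le_exp_norm _).trans (Real.exp_le_exp.2 ?_)
    rw [norm_mul, Complex.norm_real, Real.norm_of_nonneg hr.le]
    gcongr
    linarith
  simp only [Function.uncurry_apply_pair, norm_mul]
  gcongr
  exact mul_nonneg (norm_nonneg _) ((norm_nonneg _).trans kernel_le)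

theorem integral_comp_sub_left_mul_exp (g : ℝ → ℂ) (c : ℂ) (τ : ℝ) :
    ∫ r in 0..τ, g (τ - r) * Complex.exp (c * r)
      = Complex.exp (c * τ) * ∫ σ in 0..τ, g σ * Complex.exp (-(c * σ)) := by
  have substitution := intervalIntegral.integral_comp_sub_left (a := 0) (b := τ)
    (fun σ : ℝ => g σ * Complex.exp (c * (τ - σ))) τ
  simp only [sub_zero, sub_self, Complex.ofReal_sub, sub_sub_cancel] at substitution
  rw [substitution, ← intervalIntegral.integral_const_mul]
  congr 1 with σ
  rw [mul_sub, sub_eq_add_neg, Complex.exp_add]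
  ring

theorem isPrimitive_integral_volterraShift_mul_exp (hℓ : 0 ≤ ℓ) (hp : Integrable p)
    (hκ : StronglyMeasurable (Function.uncurry κ)) (hk : IntegrableOn k (Ioo 0 ℓ))
    (hκk : ∀ τ ∈ Ioo 0 ℓ, ∀ σ ∈ Ioo 0 ℓ, ‖κ τ σ‖ ≤ k σ) (c : ℂ) :
    IsPrimitive 0 ℓ (fun x => ∫ r in 0..x, volterraShift p κ x r * Complex.exp (c * r))
      fun τ => p τ * (Complex.exp (c * τ) * ∫ σ in 0..τ, κ τ σ * Complex.exp (-(c * σ))) := by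
  have integrable := integrableOn_triangle_shear hp hκ hk hκk c
  have inner_eq {τ : ℝ} (hτ : 0 < τ) :
      ∫ r in Ioo 0 τ, p τ * κ τ (τ - r) * Complex.exp (c * r)
        = p τ * (Complex.exp (c * τ) * ∫ σ in 0..τ, κ τ σ * Complex.exp (-(c * σ))) := by
    rw [setIntegral_Ioo_eq hτ.le, ← integral_comp_sub_left_mul_exp (κ τ),
      ← intervalIntegral.integral_const_mul]
    simp only [mul_assoc]
  refine ⟨hℓ, ?_, fun x hx => ?_⟩
  · rw [intervalIntegrable_iff_integrableOn_Ioo_of_le hℓ]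
    exact (integrableOn_setIntegral_triangle integrable).congr_fun (fun τ hτ => inner_eq hτ.1)
      measurableSet_Ioo
  · calc ∫ r in 0..x, volterraShift p κ x r * Complex.exp (c * r)
        = ∫ r in Ioo 0 x, ∫ τ in Ioo r x, p τ * κ τ (τ - r) * Complex.exp (c * r) := by
          simp only [← setIntegral_Ioo_eq hx.1, volterraShift, integral_mul_const]
      _ = ∫ τ in Ioo 0 x, ∫ r in Ioo 0 τ, p τ * κ τ (τ - r) * Complex.exp (c * r) :=
          setIntegral_triangle_swap (integrable.mono_set fun z hz =>
            ⟨hz.1, hz.2.1, hz.2.2.trans_le hx.2⟩)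
      _ = ∫ τ in Ioo 0 x,
            p τ * (Complex.exp (c * τ) * ∫ σ in 0..τ, κ τ σ * Complex.exp (-(c * σ))) :=
          setIntegral_congr_fun measurableSet_Ioo fun τ hτ => inner_eq hτ.1
      _ = _ := by simp only [setIntegral_Ioo_eq hx.1, intervalIntegral.integral_same, zero_add]

end Fubini

/-- The first amplitude `2 + ∫_0^x α(x,r) e^{-2iρr} dr` of the Dirac system:
`y + z = e^{iρx} diracFst` for its solution with `y(0) = z(0) = 1`. -/
noncomputable def diracFst (α : ℝ → ℝ → ℂ) (ρ : ℂ) (x : ℝ) : ℂ :=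
  2 + ∫ r in 0..x, α x r * Complex.exp (-(2 * Complex.I * ρ * r))

/-- The second amplitude `∫_0^x (2p(σ) + γ(x,σ)) e^{2iρσ} dσ` of the Dirac system:
`y - z = e^{-iρx} diracSnd` for its solution with `y(0) = z(0) = 1`. -/
noncomputable def diracSnd (p : ℝ → ℂ) (γ : ℝ → ℝ → ℂ) (ρ : ℂ) (x : ℝ) : ℂ :=
  ∫ σ in 0..x, (2 * p σ + γ x σ) * Complex.exp (2 * Complex.I * ρ * σ)

section DiracKernel

variable {ℓ w C : ℝ} {p : ℝ → ℂ} {κ α γ : ℝ → ℝ → ℂ}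

theorem IsSupportedL2.integrable (hp : IsSupportedL2 ℓ p) : Integrable p :=
  (integrableOn_iff_integrable_of_support_subset fun x hx => by
    by_contra h
    exact hx (hp.eq_zero x h)).1 (MemL2.integrableOn (hp.memLp.restrict (Ioo 0 ℓ)))

namespace HasExpGrowth

theorem norm_le_of_le (hκ : HasExpGrowth w C κ) (hw : 0 ≤ w) {x : ℝ} (hx : x ≤ ℓ) (r : ℝ) :
    ‖κ x r‖ ≤ C * Real.exp (w * ℓ) := by
  have hC := hκ.nonneg
  exact (hκ.norm_le x r).trans (by gcongr)

theorem memL2_section (hκ : HasExpGrowth w C κ) (a b x : ℝ) {g : ℝ → ℝ} (hg : Measurable g) :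
    MemL2 a b fun t => κ x (g t) :=
  MemLp.of_bound (hκ.stronglyMeasurable.comp_measurable
    (measurable_const.prodMk hg)).aestronglyMeasurable _ (.of_forall fun _ => hκ.norm_le x _)

end HasExpGrowth

theorem IsDiracKernel.isPrimitive_diracFst (hℓ : 0 ≤ ℓ) (hp : IsSupportedL2 ℓ p)
    (h : IsDiracKernel p w C α γ) (ρ : ℂ) :
    IsPrimitive 0 ℓ (diracFst α ρ)
      fun x => p x * (Complex.exp (-(2 * Complex.I * ρ * x)) * diracSnd p γ ρ x) := by
  have stronglyMeasurable : StronglyMeasurable (Function.uncurry fun τ σ => 2 * p σ + γ τ σ) :=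
    ((hp.stronglyMeasurable.comp_measurable measurable_snd).const_mul 2).add
      h.growth_snd.stronglyMeasurable
  have isPrimitive := isPrimitive_integral_volterraShift_mul_exp hℓ hp.integrable
    stronglyMeasurable (k := fun σ => ‖2 * p σ‖ + C * Real.exp (w * ℓ))
    ((hp.integrable.const_mul 2).norm.integrableOn.add (integrable_const _)) (fun τ hτ σ _ =>
      norm_add_le_of_le le_rfl (h.growth_snd.norm_le_of_le h.weight.pos.le hτ.2.le σ))
    (-(2 * Complex.I * ρ))
  simp only [neg_mul, neg_neg] at isPrimitive
  rw [← h.fst_eq] at isPrimitive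
  refine ⟨hℓ, isPrimitive.intervalIntegrable, fun x hx => ?_⟩
  rw [diracFst, isPrimitive.eq_add_integral x hx]
  simp only [diracFst, diracSnd, intervalIntegral.integral_same, add_zero, zero_add]

theorem IsDiracKernel.isPrimitive_diracSnd (hℓ : 0 ≤ ℓ) (hp : IsSupportedL2 ℓ p)
    (h : IsDiracKernel p w C α γ) (ρ : ℂ) :
    IsPrimitive 0 ℓ (diracSnd p γ ρ)
      fun x => p x * (Complex.exp (2 * Complex.I * ρ * x) * diracFst α ρ x) := by
  have integrable_p (x : ℝ) : IntervalIntegrable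
      (fun σ => 2 * p σ * Complex.exp (2 * Complex.I * ρ * σ)) volume 0 x :=
    (hp.integrable.const_mul 2).intervalIntegrable.mul_continuousOn (by fun_prop)
  have integrable_γ {x : ℝ} (hx : 0 ≤ x) : IntervalIntegrable
      (fun σ => γ x σ * Complex.exp (2 * Complex.I * ρ * σ)) volume 0 x :=
    ((h.growth_snd.memL2_section 0 x x measurable_id).intervalIntegrable hx).mul_continuousOn
      (by fun_prop)
  have isPrimitive := (IsPrimitive.const_add_integral hℓ (integrable_p ℓ) 0).add
    (isPrimitive_integral_volterraShift_mul_exp hℓ hp.integrable h.growth_fst.stronglyMeasurable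
      (integrable_const _) (fun τ hτ σ _ =>
        h.growth_fst.norm_le_of_le h.weight.pos.le hτ.2.le σ) (2 * Complex.I * ρ))
  rw [← h.snd_eq] at isPrimitive
  refine isPrimitive.congr (fun x hx => ?_) (.of_forall fun x => ?_)
  · simp only [diracSnd, zero_add, add_mul]
    exact intervalIntegral.integral_add (integrable_p x) (integrable_γ hx.1)
  · simp only [diracFst]
    ring

end DiracKernel

/-! ### The transmutation kernel -/

section Existence

variable {ℓ a b w C : ℝ} {f p p' φ : ℝ → ℂ} {q : (ℝ → ℂ) → ℂ} {κ α γ : ℝ → ℝ → ℂ}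

theorem HasLogDeriv.congr (hf : HasLogDeriv a b f p)
    (hp : p =ᵐ[volume.restrict (Ioo a b)] p') : HasLogDeriv a b f p' where
  isPrimitive := hf.isPrimitive.congr (fun _ _ => rfl) (hp.mul (ae_eq_refl f))
  memL2 := hf.memL2.ae_eq hp
  ne_zero := hf.ne_zero

theorem IsRiccatiPotential.congr (hq : IsRiccatiPotential a b q p)
    (hp : p =ᵐ[volume.restrict (Ioo a b)] p') : IsRiccatiPotential a b q p' := fun φ hφ => by
  rw [hq φ hφ]
  exact integral_congr_ae (hp.mono fun x hx => by simp only [hx])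

theorem MemL2.exists_isSupportedL2 (hp : MemL2 0 ℓ p) :
    ∃ p', IsSupportedL2 ℓ p' ∧ p =ᵐ[volume.restrict (Ioo 0 ℓ)] p' := by
  obtain ⟨p₁, hp₁, hpp₁⟩ := hp.1
  exact ⟨(Ioo 0 ℓ).indicator p₁, ⟨hp₁.indicator measurableSet_Ioo,
    (memLp_indicator_iff_restrict measurableSet_Ioo).2 (hp.ae_eq hpp₁),
    fun x hx => indicator_of_notMem hx _⟩,
    hpp₁.trans (indicator_ae_eq_restrict measurableSet_Ioo).symm⟩

theorem IsRiccatiPotential.isExpSolution (hℓ : 0 < ℓ) (hf : HasLogDeriv 0 ℓ f p)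
    (hq : IsRiccatiPotential 0 ℓ q p) {ρ : ℂ} {y z : ℝ → ℂ}
    (hy : IsPrimitive 0 ℓ y fun x => p x * y x + Complex.I * ρ * z x)
    (hz : IsPrimitive 0 ℓ z fun x => -(p x * z x) + Complex.I * ρ * y x)
    (hy0 : y 0 = 1) (hz0 : z 0 = 1) : IsExpSolution ℓ q f ρ y := by
  have memL2_deriv : MemL2 0 ℓ fun x => p x * y x + Complex.I * ρ * z x :=
    (hf.memL2.mul_continuousOn hy.continuousOn).add
      (memL2_of_continuousOn (continuousOn_const.mul hz.continuousOn))
  have hasACRepr := hy.hasACRepr memL2_deriv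
  have quasiDeriv : IsPrimitive 0 ℓ (fun x => Complex.I * ρ * (f x * z x))
      fun x => -(f x * (ρ ^ 2 * y x)) :=
    ((hf.isPrimitive.mul hz).const_mul _).congr (fun _ _ => rfl) (.of_forall fun x => by
      linear_combination f x * ρ ^ 2 * y x * Complex.I_sq)
  have eq := hq.schrodingerEq hℓ hf hasACRepr (g := fun x => ρ ^ 2 * y x)
    (memL2_of_continuousOn (continuousOn_const.mul hy.continuousOn)) quasiDeriv
    (.of_forall fun x => by ring)
  refine ⟨hy.continuousOn, ⟨hasACRepr.memW12, _, eq⟩, eq, hy0, fun x => Complex.I * ρ * z x,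
    continuousOn_const.mul hz.continuousOn, ?_, by simp [hz0]⟩
  filter_upwards [hf.opD_ae_eq hasACRepr] with x hx
  rw [hx]
  ring

theorem measurableSet_triangle (ℓ : ℝ) : MeasurableSet (triangle ℓ) :=
  (measurableSet_le measurable_const measurable_fst).inter
    ((measurableSet_le measurable_fst measurable_const).inter
      (measurableSet_le (by fun_prop) measurable_fst))

theorem isFiniteMeasure_restrict_triangle (ℓ : ℝ) :
    IsFiniteMeasure ((volume : Measure (ℝ × ℝ)).restrict (triangle ℓ)) := by
  have subset_box : triangle ℓ ⊆ Icc (0, -ℓ) (ℓ, ℓ) := fun _ hz =>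
    ⟨⟨hz.1, neg_le_of_abs_le (hz.2.2.trans hz.2.1)⟩, hz.2.1, le_of_abs_le (hz.2.2.trans hz.2.1)⟩
  exact isFiniteMeasure_restrict.2
    (ne_top_of_le_ne_top isCompact_Icc.measure_lt_top.ne (measure_mono subset_box))

theorem HasExpGrowth.memLp_triangle (hκ : HasExpGrowth w C κ) (hw : 0 ≤ w) {g : ℝ × ℝ → ℝ}
    (hg : Measurable g) :
    MemLp (fun z : ℝ × ℝ => κ z.1 (g z)) 2 (volume.restrict (triangle ℓ)) :=
  have := isFiniteMeasure_restrict_triangle ℓ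
  .of_bound (hκ.stronglyMeasurable.comp_measurable
    (measurable_fst.prodMk hg)).aestronglyMeasurable (C * Real.exp (w * ℓ))
    ((ae_restrict_iff' (measurableSet_triangle ℓ)).2
      (.of_forall fun _ hz => hκ.norm_le_of_le hw hz.2.1 _))

theorem IsSupportedL2.memLp_comp_midpoint (hp : IsSupportedL2 ℓ p) (x : ℝ) :
    MemLp (fun t => p ((x + t) / 2)) 2 :=
  (memLp_two_iff_integrable_sq_norm (hp.stronglyMeasurable.comp_measurable
    (by fun_prop)).aestronglyMeasurable).2
    ((hp.integrable_sq.comp_div two_ne_zero).comp_add_left x)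

theorem IsSupportedL2.memLp_triangle (hp : IsSupportedL2 ℓ p) :
    MemLp (fun z : ℝ × ℝ => p ((z.1 + z.2) / 2)) 2 (volume.restrict (triangle ℓ)) := by
  have stronglyMeasurable : StronglyMeasurable fun z : ℝ × ℝ => p ((z.1 + z.2) / 2) :=
    hp.stronglyMeasurable.comp_measurable (by fun_prop)
  have restrict_le : (volume : Measure (ℝ × ℝ)).restrict (triangle ℓ)
      ≤ (volume.restrict (Icc 0 ℓ)).prod volume := by
    have restrict_strip := Measure.prod_restrict (μ := (volume : Measure ℝ))
      (ν := (volume : Measure ℝ)) (Icc 0 ℓ) univ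
    rw [Measure.restrict_univ] at restrict_strip
    rw [restrict_strip]
    exact Measure.restrict_mono
      (show triangle ℓ ⊆ Icc 0 ℓ ×ˢ univ from fun _ hz => ⟨⟨hz.1, hz.2.1⟩, mem_univ _⟩) le_rfl
  refine MemLp.mono_measure restrict_le ?_
  rw [memLp_two_iff_integrable_sq_norm stronglyMeasurable.aestronglyMeasurable,
    integrable_prod_iff (by exact (stronglyMeasurable.norm.pow 2).aestronglyMeasurable)]
  refine ⟨.of_forall fun x => (hp.memLp_comp_midpoint x).integrable_norm_pow two_ne_zero, ?_⟩
  simp only [integral_add_left_eq_self (fun t => ‖‖p (t / 2)‖ ^ 2‖)]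
  exact integrable_const _

theorem integral_comp_midpoint_mul_exp (φ : ℝ → ℂ) (c : ℂ) (x : ℝ) :
    ∫ t in (-x)..x, φ ((x + t) / 2) * Complex.exp (c * t)
      = 2 * (Complex.exp (-(c * x)) * ∫ r in 0..x, φ r * Complex.exp (2 * c * r)) := by
  have substitution := intervalIntegral.integral_comp_add_div (a := -x) (b := x)
    (fun r : ℝ => φ r * Complex.exp (c * (2 * r - x))) two_ne_zero (x / 2)
  rw [show x / 2 + x / 2 = x by ring, show x / 2 + -x / 2 = 0 by ring, Complex.real_smul,
    Complex.ofReal_ofNat] at substitution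
  rw [← intervalIntegral.integral_const_mul]
  convert substitution using 1
  · congr 1 with t
    congr 2
    · ring
    · push_cast
      ring
  · congr 2 with r
    rw [mul_left_comm, ← Complex.exp_add]
    ring_nf

theorem integral_comp_midpoint_neg_mul_exp (φ : ℝ → ℂ) (c : ℂ) (x : ℝ) :
    ∫ t in (-x)..x, φ ((x - t) / 2) * Complex.exp (c * t)
      = 2 * (Complex.exp (c * x) * ∫ r in 0..x, φ r * Complex.exp (-(2 * c * r))) := by
  have reflection := intervalIntegral.integral_comp_neg (a := -x) (b := x)
    fun t : ℝ => φ ((x + t) / 2) * Complex.exp (-c * t)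
  rw [neg_neg, integral_comp_midpoint_mul_exp] at reflection
  simpa [← sub_eq_add_neg] using reflection

/-- The transmutation kernel of the Dirac system with potential `p`, in terms of its kernels `α`
and `γ`: in `y = (e^{iρx} diracFst + e^{-iρx} diracSnd) / 2` the exponents `±iρ(x - 2r)` are
renamed `iρt`. -/
noncomputable def diracTransKernel (p : ℝ → ℂ) (α γ : ℝ → ℝ → ℂ) (x t : ℝ) : ℂ :=
  4⁻¹ * α x ((x - t) / 2) + 4⁻¹ * (2 * p ((x + t) / 2) + γ x ((x + t) / 2))

namespace IsDiracKernel

theorem memLp_triangle (hp : IsSupportedL2 ℓ p) (h : IsDiracKernel p w C α γ) :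
    MemLp (Function.uncurry (diracTransKernel p α γ)) 2 (volume.restrict (triangle ℓ)) :=
  ((h.growth_fst.memLp_triangle h.weight.pos.le (by fun_prop)).const_mul _).add
    (((hp.memLp_triangle.const_mul _).add
      (h.growth_snd.memLp_triangle h.weight.pos.le (by fun_prop))).const_mul _)

theorem memL2_comp_fst (h : IsDiracKernel p w C α γ) (a b x : ℝ) :
    MemL2 a b fun t => α x ((x - t) / 2) :=
  h.growth_fst.memL2_section a b x (by fun_prop)

theorem memL2_comp_snd (hp : IsSupportedL2 ℓ p) (h : IsDiracKernel p w C α γ) (a b x : ℝ) :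
    MemL2 a b fun t => 2 * p ((x + t) / 2) + γ x ((x + t) / 2) :=
  MemLp.add (((hp.memLp_comp_midpoint x).restrict _).const_mul 2)
    (h.growth_snd.memL2_section a b x (by fun_prop))

theorem transOp_exp (hp : IsSupportedL2 ℓ p) (h : IsDiracKernel p w C α γ) (ρ : ℂ) {x : ℝ}
    (hx : 0 ≤ x) :
    transOp (diracTransKernel p α γ) (fun t : ℝ => Complex.exp (Complex.I * ρ * t)) x
      = 2⁻¹ * (Complex.exp (Complex.I * ρ * x) * diracFst α ρ x)
        + 2⁻¹ * (Complex.exp (-(Complex.I * ρ * x)) * diracSnd p γ ρ x) := by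
  have integrable_mul_exp {g : ℝ → ℂ} (hg : MemL2 (-x) x g) : IntervalIntegrable
      (fun t => g t * Complex.exp (Complex.I * ρ * t)) volume (-x) x :=
    (hg.intervalIntegrable (by linarith)).mul_continuousOn (by fun_prop)
  simp only [transOp, diracTransKernel, add_mul ((4⁻¹ : ℂ) * _), mul_assoc (4⁻¹ : ℂ)]
  rw [intervalIntegral.integral_add ((integrable_mul_exp (h.memL2_comp_fst _ _ x)).const_mul _)
    ((integrable_mul_exp (h.memL2_comp_snd hp _ _ x)).const_mul _),
    intervalIntegral.integral_const_mul, intervalIntegral.integral_const_mul,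
    integral_comp_midpoint_neg_mul_exp (α x),
    integral_comp_midpoint_mul_exp fun r => 2 * p r + γ x r, diracFst, diracSnd]
  simp only [← mul_assoc]
  ring

end IsDiracKernel

theorem isPrimitive_exp (hab : a ≤ b) (c : ℂ) :
    IsPrimitive a b (fun x => Complex.exp (c * x)) fun x => c * Complex.exp (c * x) :=
  .of_hasDerivAt hab (fun x => by
    simpa [mul_comm] using ((hasDerivAt_id x).ofReal_comp.const_mul c).cexp) (by fun_prop)

theorem IsDiracKernel.isExpSolution (hℓ : 0 < ℓ) (hp : IsSupportedL2 ℓ p)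
    (h : IsDiracKernel p w C α γ) (hf : HasLogDeriv 0 ℓ f p) (hq : IsRiccatiPotential 0 ℓ q p)
    (ρ : ℂ) : IsExpSolution ℓ q f ρ fun x =>
      2⁻¹ * (Complex.exp (Complex.I * ρ * x) * diracFst α ρ x)
        + 2⁻¹ * (Complex.exp (-(Complex.I * ρ) * x) * diracSnd p γ ρ x) := by
  have sum := (isPrimitive_exp hℓ.le (Complex.I * ρ)).mul (h.isPrimitive_diracFst hℓ.le hp ρ)
  have diff := (isPrimitive_exp hℓ.le (-(Complex.I * ρ))).mul (h.isPrimitive_diracSnd hℓ.le hp ρ)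
  have exp_mul_fst (x : ℝ) : Complex.exp (Complex.I * ρ * x)
      * Complex.exp (-(2 * Complex.I * ρ * x)) = Complex.exp (-(Complex.I * ρ) * x) := by
    rw [← Complex.exp_add]
    ring_nf
  have exp_mul_snd (x : ℝ) : Complex.exp (-(Complex.I * ρ) * x)
      * Complex.exp (2 * Complex.I * ρ * x) = Complex.exp (Complex.I * ρ * x) := by
    rw [← Complex.exp_add]
    ring_nf
  refine hq.isExpSolution hℓ hf
    (((sum.const_mul 2⁻¹).add (diff.const_mul 2⁻¹)).congr (fun _ _ => rfl) (.of_forall fun x => ?_))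
    (((sum.const_mul 2⁻¹).add (diff.const_mul (-2⁻¹))).congr (fun _ _ => rfl)
      (.of_forall fun x => ?_)) (by simp [diracFst, diracSnd]) (by simp [diracFst, diracSnd])
  · linear_combination 2⁻¹ * p x * diracSnd p γ ρ x * exp_mul_fst x
      + 2⁻¹ * p x * diracFst α ρ x * exp_mul_snd x
  · linear_combination 2⁻¹ * p x * diracSnd p γ ρ x * exp_mul_fst x
      - 2⁻¹ * p x * diracFst α ρ x * exp_mul_snd x

theorem IsDiracKernel.isTransmutationKernel (hℓ : 0 < ℓ) (hp : IsSupportedL2 ℓ p)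
    (h : IsDiracKernel p w C α γ) (hf : HasLogDeriv 0 ℓ f p) (hq : IsRiccatiPotential 0 ℓ q p) :
    IsTransmutationKernel ℓ q f (diracTransKernel p α γ) where
  memLp := h.memLp_triangle hp
  memLp_section x _ := ((h.memL2_comp_fst _ _ x).const_mul _).add
    ((h.memL2_comp_snd hp _ _ x).const_mul _)
  representation ρ := ⟨_, h.isExpSolution hℓ hp hf hq ρ, fun x hx => by
    simp only [h.transOp_exp hp ρ hx.1.le, neg_mul]⟩

theorem exists_isTransmutationKernel (hℓ : 0 < ℓ) (hf : HasLogDeriv 0 ℓ f p)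
    (hq : IsRiccatiPotential 0 ℓ q p) : ∃ K, IsTransmutationKernel ℓ q f K := by
  obtain ⟨p', hp', hpp'⟩ := hf.memL2.exists_isSupportedL2
  obtain ⟨w, C, α, γ, h⟩ := hp'.exists_isDiracKernel
  exact ⟨_, h.isTransmutationKernel hℓ hp' (hf.congr hpp') (hq.congr hpp')⟩

end Existence

/-! ### Bounded functionals on `L²` -/

section NormL2

variable {a b c d C : ℝ} {u v k : ℝ → ℂ}

/-- The norm of `L²(a,b)`. -/
noncomputable def normL2 (a b : ℝ) (u : ℝ → ℂ) : ℝ :=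
  Real.sqrt (∫ x in Ioo a b, ‖u x‖ ^ 2)

theorem normL2_nonneg (a b : ℝ) (u : ℝ → ℂ) : 0 ≤ normL2 a b u := Real.sqrt_nonneg _

namespace MemL2

theorem integrableOn_sq (hu : MemL2 a b u) : IntegrableOn (fun x => ‖u x‖ ^ 2) (Ioo a b) :=
  (memLp_two_iff_integrable_sq_norm hu.1).1 hu

theorem mono (hu : MemL2 a b u) (hac : a ≤ c) (hdb : d ≤ b) : MemL2 c d u :=
  MemLp.mono_measure (Measure.restrict_mono (Ioo_subset_Ioo hac hdb) le_rfl) hu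

theorem normL2_mono (hu : MemL2 a b u) (hac : a ≤ c) (hdb : d ≤ b) :
    normL2 c d u ≤ normL2 a b u :=
  Real.sqrt_le_sqrt (setIntegral_mono_set hu.integrableOn_sq (.of_forall fun x => by positivity)
    (Ioo_subset_Ioo hac hdb).eventuallyLE)

theorem normL2_eq (hu : MemL2 a b u) :
    normL2 a b u = (eLpNorm u 2 (volume.restrict (Ioo a b))).toReal := by
  rw [MemLp.eLpNorm_eq_integral_rpow_norm (by norm_num) (by norm_num) hu,
    ENNReal.toReal_ofReal (by positivity), normL2, Real.sqrt_eq_rpow]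
  norm_num

theorem normL2_add_le (hu : MemL2 a b u) (hv : MemL2 a b v) :
    normL2 a b (fun x => u x + v x) ≤ normL2 a b u + normL2 a b v := by
  rw [hu.normL2_eq, hv.normL2_eq, (hu.add hv).normL2_eq, ← ENNReal.toReal_add hu.2.ne hv.2.ne]
  exact ENNReal.toReal_mono (ENNReal.add_ne_top.2 ⟨hu.2.ne, hv.2.ne⟩)
    (eLpNorm_add_le hu.1 hv.1 one_le_two)

theorem normL2_le_of_norm_le (hv : MemL2 a b v) (hC : 0 ≤ C)
    (hle : ∀ x ∈ Ioo a b, ‖u x‖ ≤ C * ‖v x‖) : normL2 a b u ≤ C * normL2 a b v := by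
  rw [normL2, normL2, ← Real.sqrt_sq hC, ← Real.sqrt_mul (sq_nonneg C), ← integral_const_mul]
  refine Real.sqrt_le_sqrt (integral_mono_of_nonneg (.of_forall fun x => by positivity)
    (hv.integrableOn_sq.const_mul _) ((ae_restrict_iff' measurableSet_Ioo).2
      (.of_forall fun x hx => ?_)))
  exact (pow_le_pow_left₀ (norm_nonneg _) (hle x hx) 2).trans_eq (mul_pow _ _ _)

theorem norm_setIntegral_mul_le (hk : MemL2 a b k) (hu : MemL2 a b u) :
    ‖∫ x in Ioo a b, k x * u x‖ ≤ normL2 a b k * normL2 a b u := by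
  have hoelder := integral_mul_le_Lp_mul_Lq_of_nonneg (μ := volume.restrict (Ioo a b))
    Real.HolderConjugate.two_two (f := fun x => ‖k x‖) (g := fun x => ‖u x‖)
    (.of_forall fun x => norm_nonneg _) (.of_forall fun x => norm_nonneg _)
    (by simpa using MemLp.norm hk) (by simpa using MemLp.norm hu)
  refine (norm_integral_le_integral_norm _).trans ?_
  simpa only [norm_mul, normL2, Real.sqrt_eq_rpow, Real.rpow_two] using hoelder

theorem norm_intervalIntegral_mul_le (hk : MemL2 c d k) (hu : MemL2 a b u) (hac : a ≤ c)
    (hcd : c ≤ d) (hdb : d ≤ b) :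
    ‖∫ x in c..d, k x * u x‖ ≤ normL2 c d k * normL2 a b u := by
  rw [← setIntegral_Ioo_eq hcd]
  exact (hk.norm_setIntegral_mul_le (hu.mono hac hdb)).trans
    (mul_le_mul_of_nonneg_left (hu.normL2_mono hac hdb) (normL2_nonneg _ _ _))

end MemL2

end NormL2

section Density

variable {a b ε : ℝ} {G g u : ℝ → ℂ}

theorem exists_complex_polynomial_near_of_continuousOn (hG : ContinuousOn G (Icc a b))
    (hε : 0 < ε) : ∃ R : Polynomial ℂ, ∀ s ∈ Icc a b, ‖G s - R.eval (s : ℂ)‖ ≤ ε := by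
  obtain ⟨P, hP⟩ := exists_polynomial_near_of_continuousOn a b (fun s => (G s).re)
    (Complex.continuous_re.comp_continuousOn hG) (ε / 2) (half_pos hε)
  obtain ⟨Q, hQ⟩ := exists_polynomial_near_of_continuousOn a b (fun s => (G s).im)
    (Complex.continuous_im.comp_continuousOn hG) (ε / 2) (half_pos hε)
  have eval_map (S : Polynomial ℝ) (s : ℝ) :
      (S.map Complex.ofRealHom).eval (s : ℂ) = (S.eval s : ℝ) := by
    simpa using Polynomial.eval_map_apply (p := S) Complex.ofRealHom s
  refine ⟨P.map Complex.ofRealHom + Polynomial.C Complex.I * Q.map Complex.ofRealHom,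
    fun s hs => (Complex.norm_le_abs_re_add_abs_im _).trans ?_⟩
  have near_re := hP s hs
  have near_im := hQ s hs
  rw [abs_sub_comm] at near_re near_im
  simp only [Polynomial.eval_add, Polynomial.eval_mul, Polynomial.eval_C, eval_map,
    Complex.sub_re, Complex.sub_im, Complex.add_re, Complex.add_im, Complex.re_mul_ofReal,
    Complex.im_mul_ofReal, Complex.ofReal_re, Complex.ofReal_im, Complex.I_re, Complex.I_im,
    zero_mul, one_mul, add_zero, zero_add]
  linarith

/-- A linear combination of the functions `e^{(n+1)t}`, that is, `e^t R(e^t)` with a polynomial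
`R`. -/
noncomputable def expPolynomial (R : Polynomial ℂ) (t : ℝ) : ℂ :=
  ∑ i ∈ Finset.range (R.natDegree + 1), R.coeff i * Complex.exp (((i : ℂ) + 1) * t)

theorem expPolynomial_eq (R : Polynomial ℂ) (t : ℝ) :
    expPolynomial R t = Real.exp t * R.eval ((Real.exp t : ℝ) : ℂ) := by
  rw [expPolynomial, Polynomial.eval_eq_sum_range, Finset.mul_sum]
  refine Finset.sum_congr rfl fun i _ => ?_
  rw [add_mul, Complex.exp_add, one_mul, Complex.exp_nat_mul, Complex.ofReal_exp]
  ring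

theorem memL2_expPolynomial (a b : ℝ) (R : Polynomial ℂ) : MemL2 a b (expPolynomial R) :=
  memL2_of_continuousOn (Continuous.continuousOn (by unfold expPolynomial; fun_prop))

theorem exists_expPolynomial_near_of_continuousOn (hg : ContinuousOn g (Icc a b)) (hε : 0 < ε) :
    ∃ R, ∀ t ∈ Icc a b, ‖g t - expPolynomial R t‖ ≤ ε := by
  have exp_pos_of_mem : ∀ s ∈ Icc (Real.exp a) (Real.exp b), 0 < s := fun s hs =>
    (Real.exp_pos a).trans_le hs.1
  have continuousOn_log : ContinuousOn Real.log (Icc (Real.exp a) (Real.exp b)) :=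
    Real.continuousOn_log.mono fun s hs => (exp_pos_of_mem s hs).ne'
  have continuousOn_comp_log : ContinuousOn (fun s => g (Real.log s) / s)
      (Icc (Real.exp a) (Real.exp b)) :=
    (hg.comp continuousOn_log fun s hs =>
      ⟨(Real.le_log_iff_exp_le (exp_pos_of_mem s hs)).2 hs.1,
        (Real.log_le_iff_le_exp (exp_pos_of_mem s hs)).2 hs.2⟩).div
      (by fun_prop) fun s hs => by exact_mod_cast (exp_pos_of_mem s hs).ne'
  obtain ⟨R, hR⟩ := exists_complex_polynomial_near_of_continuousOn continuousOn_comp_log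
    (ε := ε / Real.exp b) (by positivity)
  refine ⟨R, fun t ht => ?_⟩
  have eq_mul : g t - expPolynomial R t
      = Real.exp t * (g (Real.log (Real.exp t)) / Real.exp t - R.eval ((Real.exp t : ℝ) : ℂ)) := by
    have exp_ne_zero : ((Real.exp t : ℝ) : ℂ) ≠ 0 := by exact_mod_cast (Real.exp_pos t).ne'
    rw [expPolynomial_eq, Real.log_exp]
    field_simp
  rw [eq_mul, norm_mul, Complex.norm_real, Real.norm_eq_abs, Real.abs_exp]
  calc _ ≤ Real.exp b * (ε / Real.exp b) := by
        gcongr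
        · exact ht.2
        · exact hR _ ⟨Real.exp_le_exp.2 ht.1, Real.exp_le_exp.2 ht.2⟩
    _ = ε := by field_simp

theorem MemL2.exists_expPolynomial_near (hu : MemL2 a b u) (hε : 0 < ε) :
    ∃ R, normL2 a b (fun t => u t - expPolynomial R t) ≤ ε := by
  obtain ⟨g, -, hug, hg, -⟩ := MemLp.exists_hasCompactSupport_eLpNorm_sub_le (by norm_num) hu
    (ε := ENNReal.ofReal (ε / 2)) (by simpa using hε)
  set δ := ε / (2 * (normL2 a b 1 + 1)) with hδ
  have norm_one_nonneg := normL2_nonneg a b 1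
  have hδ0 : 0 < δ := by positivity
  obtain ⟨R, hR⟩ := exists_expPolynomial_near_of_continuousOn (a := a) (b := b) hg.continuousOn hδ0
  have memL2_g : MemL2 a b g := memL2_of_continuousOn hg.continuousOn
  have near_g : normL2 a b (fun t => u t - g t) ≤ ε / 2 := by
    rw [(hu.sub memL2_g).normL2_eq]
    exact ENNReal.toReal_le_of_le_ofReal (half_pos hε).le hug
  have g_near : normL2 a b (fun t => g t - expPolynomial R t) ≤ ε / 2 := by
    calc _ ≤ δ * normL2 a b 1 := MemL2.normL2_le_of_norm_le
          (memL2_of_continuousOn continuousOn_const) hδ0.le fun t ht => by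
            simpa using hR t (Ioo_subset_Icc_self ht)
      _ ≤ δ * (normL2 a b 1 + 1) := by gcongr; linarith
      _ = ε / 2 := by rw [hδ]; field_simp
  refine ⟨R, ?_⟩
  have triangle_ineq := (hu.sub memL2_g).normL2_add_le (memL2_g.sub (memL2_expPolynomial a b R))
  simp only [sub_add_sub_cancel] at triangle_ineq
  linarith

end Density

section Functional

variable {a b c d : ℝ} {k u : ℝ → ℂ} {Φ Ψ : (ℝ → ℂ) → ℂ}

/-- A bounded linear functional on `L²(a,b)`. The values of `Φ` off `L²(a,b)` are irrelevant. -/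
structure IsL2Functional (a b : ℝ) (Φ : (ℝ → ℂ) → ℂ) : Prop where
  map_add : ∀ u v, MemL2 a b u → MemL2 a b v → Φ (fun t => u t + v t) = Φ u + Φ v
  map_const_mul : ∀ (c : ℂ) (u), MemL2 a b u → Φ (fun t => c * u t) = c * Φ u
  bounded : ∃ C, ∀ u, MemL2 a b u → ‖Φ u‖ ≤ C * normL2 a b u

namespace IsL2Functional

theorem congr (hΦ : IsL2Functional a b Φ) (hΨ : ∀ u, MemL2 a b u → Ψ u = Φ u) :
    IsL2Functional a b Ψ where
  map_add u v hu hv := by rw [hΨ _ hu, hΨ _ hv, hΨ _ (hu.add hv), hΦ.map_add u v hu hv]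
  map_const_mul c u hu := by rw [hΨ _ hu, hΨ _ (MemLp.const_mul hu c), hΦ.map_const_mul c u hu]
  bounded := hΦ.bounded.imp fun C hC u hu => hΨ u hu ▸ hC u hu

theorem add (hΦ : IsL2Functional a b Φ) (hΨ : IsL2Functional a b Ψ) :
    IsL2Functional a b (fun u => Φ u + Ψ u) where
  map_add u v hu hv := by
    rw [hΦ.map_add u v hu hv, hΨ.map_add u v hu hv]
    ring
  map_const_mul c u hu := by rw [hΦ.map_const_mul c u hu, hΨ.map_const_mul c u hu, mul_add]
  bounded := by
    obtain ⟨C, hC⟩ := hΦ.bounded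
    obtain ⟨D, hD⟩ := hΨ.bounded
    exact ⟨C + D, fun u hu => (norm_add_le_of_le (hC u hu) (hD u hu)).trans_eq (add_mul _ _ _).symm⟩

theorem const_mul (hΦ : IsL2Functional a b Φ) (c : ℂ) : IsL2Functional a b (fun u => c * Φ u) where
  map_add u v hu hv := by rw [hΦ.map_add u v hu hv, mul_add]
  map_const_mul d u hu := by rw [hΦ.map_const_mul d u hu, mul_left_comm]
  bounded := by
    obtain ⟨C, hC⟩ := hΦ.bounded
    refine ⟨‖c‖ * C, fun u hu => ?_⟩
    rw [norm_mul, mul_assoc]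
    exact mul_le_mul_of_nonneg_left (hC u hu) (norm_nonneg c)

theorem apply_expPolynomial (hΦ : IsL2Functional a b Φ) (R : Polynomial ℂ)
    (hexp : ∀ n : ℕ, Φ (fun t => Complex.exp (((n : ℂ) + 1) * t)) = 0) :
    Φ (expPolynomial R) = 0 := by
  have memL2_exp (n : ℕ) : MemL2 a b fun t : ℝ => Complex.exp (((n : ℂ) + 1) * t) :=
    memL2_of_continuousOn (Continuous.continuousOn (by fun_prop))
  have apply_sum (n : ℕ) : Φ (fun t : ℝ => ∑ i ∈ Finset.range n,
      R.coeff i * Complex.exp (((i : ℂ) + 1) * t)) = 0 := by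
    induction n with
    | zero => simpa using hΦ.map_const_mul 0 _ (memL2_exp 0)
    | succ n ih =>
      simp only [Finset.sum_range_succ]
      rw [hΦ.map_add _ _ (memL2_of_continuousOn (Continuous.continuousOn (by fun_prop)))
        (MemLp.const_mul (memL2_exp n) _), ih, hΦ.map_const_mul _ _ (memL2_exp n), hexp, mul_zero,
        add_zero]
  exact apply_sum _

theorem eq_zero_of_exp (hΦ : IsL2Functional a b Φ)
    (hexp : ∀ n : ℕ, Φ (fun t => Complex.exp (((n : ℂ) + 1) * t)) = 0) (hu : MemL2 a b u) :
    Φ u = 0 := by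
  obtain ⟨C, hC⟩ := hΦ.bounded
  refine norm_le_zero_iff.1 (le_of_forall_pos_le_add fun ε hε => ?_)
  obtain ⟨R, hR⟩ := hu.exists_expPolynomial_near (ε := ε / (|C| + 1)) (by positivity)
  have memL2_sub := hu.sub (memL2_expPolynomial a b R)
  have apply_sub := hΦ.map_add _ _ memL2_sub (memL2_expPolynomial a b R)
  simp only [sub_add_cancel, hΦ.apply_expPolynomial R hexp, add_zero] at apply_sub
  have norm_nonneg := normL2_nonneg a b fun t => u t - expPolynomial R t
  calc ‖Φ u‖ = ‖Φ fun t => u t - expPolynomial R t‖ := congrArg _ apply_sub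
    _ ≤ C * normL2 a b (fun t => u t - expPolynomial R t) := hC _ memL2_sub
    _ ≤ (|C| + 1) * (ε / (|C| + 1)) := by gcongr; linarith [le_abs_self C]
    _ = 0 + ε := by field_simp; ring

theorem integral {S : Type*} [MeasurableSpace S] {μ : Measure S} {Φ : S → (ℝ → ℂ) → ℂ}
    {C : S → ℝ} (hΦ : ∀ᵐ s ∂μ, IsL2Functional a b (Φ s)) (hC : Integrable C μ)
    (hle : ∀ᵐ s ∂μ, ∀ u, MemL2 a b u → ‖Φ s u‖ ≤ C s * normL2 a b u)
    (hmeas : ∀ u, MemL2 a b u → AEStronglyMeasurable (fun s => Φ s u) μ) :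
    IsL2Functional a b fun u => ∫ s, Φ s u ∂μ := by
  have norm_le {u : ℝ → ℂ} (hu : MemL2 a b u) : ∀ᵐ s ∂μ, ‖Φ s u‖ ≤ C s * normL2 a b u :=
    hle.mono fun s hs => hs u hu
  have integrable {u : ℝ → ℂ} (hu : MemL2 a b u) : Integrable (fun s => Φ s u) μ :=
    (hC.mul_const _).mono' (hmeas u hu) (norm_le hu)
  refine ⟨fun u v hu hv => ?_, fun c u hu => ?_, ∫ s, C s ∂μ, fun u hu => ?_⟩
  · rw [← integral_add (integrable hu) (integrable hv)]
    exact integral_congr_ae (hΦ.mono fun s hs => hs.map_add u v hu hv)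
  · rw [← integral_const_mul]
    exact integral_congr_ae (hΦ.mono fun s hs => hs.map_const_mul c u hu)
  · rw [← integral_mul_const]
    exact norm_integral_le_of_norm_le (hC.mul_const _) (norm_le hu)

end IsL2Functional

theorem MemL2.isL2Functional_integral_mul (hk : MemL2 c d k) (hac : a ≤ c) (hcd : c ≤ d)
    (hdb : d ≤ b) : IsL2Functional a b fun u => ∫ t in c..d, k t * u t where
  map_add u v hu hv := by
    have intervalIntegrable_mul {w : ℝ → ℂ} (hw : MemL2 a b w) :
        IntervalIntegrable (fun t => k t * w t) volume c d :=
      (intervalIntegrable_iff_integrableOn_Ioo_of_le hcd).2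
        (hk.integrableOn_mul (hw.mono hac hdb))
    rw [← intervalIntegral.integral_add (intervalIntegrable_mul hu) (intervalIntegrable_mul hv)]
    simp only [mul_add]
  map_const_mul z u _ := by
    rw [← intervalIntegral.integral_const_mul]
    simp only [mul_left_comm]
  bounded := ⟨normL2 c d k, fun u hu => hk.norm_intervalIntegral_mul_le hu hac hcd hdb⟩

theorem isL2Functional_integral (hac : a ≤ c) (hcd : c ≤ d) (hdb : d ≤ b) :
    IsL2Functional a b fun u => ∫ t in c..d, u t := by
  simpa only [one_mul] using (memL2_of_continuousOn (u := fun _ => 1)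
    continuousOn_const).isL2Functional_integral_mul hac hcd hdb

theorem MemL2.norm_integral_le (hu : MemL2 a b u) (hac : a ≤ c) (hcd : c ≤ d) (hdb : d ≤ b) :
    ‖∫ t in c..d, u t‖ ≤ normL2 a b 1 * normL2 a b u := by
  have memL2_one (x y : ℝ) : MemL2 x y 1 := memL2_of_continuousOn continuousOn_const
  have norm_le := (memL2_one c d).norm_intervalIntegral_mul_le hu hac hcd hdb
  simp only [Pi.one_apply, one_mul] at norm_le
  exact norm_le.trans (mul_le_mul_of_nonneg_right ((memL2_one a b).normL2_mono hac hdb)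
    (normL2_nonneg _ _ _))

theorem MemL2.isPrimitive_integral (hab : a ≤ b) (hu : MemL2 a b u) :
    IsPrimitive a b (fun t => ∫ s in a..t, u s) u := by
  simpa only [zero_add] using IsPrimitive.const_add_integral hab (hu.intervalIntegrable hab) 0

theorem MemL2.isL2Functional_integral_mul_integral (hk : MemL2 c d k) (hac : a ≤ c) (hcd : c ≤ d)
    (hdb : d ≤ b) : IsL2Functional a b fun u => ∫ t in c..d, k t * ∫ s in a..t, u s := by
  have hab : a ≤ b := hac.trans (hcd.trans hdb)
  simp only [← setIntegral_Ioo_eq hcd]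
  refine .integral (C := fun t => ‖k t‖ * normL2 a b 1) ?_ (hk.integrableOn.norm.mul_const _) ?_
    fun u hu => hk.1.mul (((hu.isPrimitive_integral hab).continuousOn.mono
      (Ioo_subset_Icc_self.trans (Icc_subset_Icc hac hdb))).aestronglyMeasurable measurableSet_Ioo)
  · filter_upwards [ae_restrict_mem measurableSet_Ioo] with t ht
    exact (isL2Functional_integral le_rfl (hac.trans ht.1.le) (ht.2.le.trans hdb)).const_mul _
  · filter_upwards [ae_restrict_mem measurableSet_Ioo] with t ht u hu
    rw [norm_mul, mul_assoc]
    exact mul_le_mul_of_nonneg_left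
      (hu.norm_integral_le le_rfl (hac.trans ht.1.le) (ht.2.le.trans hdb)) (norm_nonneg _)

end Functional

/-! ### Square integrable kernels on the triangle -/

section TransOp

variable {K : ℝ → ℝ → ℂ} {u v : ℝ → ℂ} {x ℓ : ℝ}

theorem transOp_const_mul (K : ℝ → ℝ → ℂ) (c : ℂ) (u : ℝ → ℂ) (x : ℝ) :
    transOp K (fun t => c * u t) x = c * transOp K u x := by
  simp only [transOp, mul_left_comm, intervalIntegral.integral_const_mul, mul_add]

theorem transOp_add (hx : 0 ≤ x) (hK : MemL2 (-x) x (K x)) (hu : MemL2 (-x) x u)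
    (hv : MemL2 (-x) x v) :
    transOp K (fun t => u t + v t) x = transOp K u x + transOp K v x := by
  have intervalIntegrable_mul {w : ℝ → ℂ} (hw : MemL2 (-x) x w) :
      IntervalIntegrable (fun t => K x t * w t) volume (-x) x :=
    (intervalIntegrable_iff_integrableOn_Ioo_of_le (by linarith)).2 (hK.integrableOn_mul hw)
  simp only [transOp, mul_add]
  rw [intervalIntegral.integral_add (intervalIntegrable_mul hu) (intervalIntegrable_mul hv)]
  ring

theorem transOp_congr_ae (hℓ : 0 ≤ ℓ) (huv : u =ᵐ[volume.restrict (Ioo (-ℓ) ℓ)] v) :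
    transOp K u =ᵐ[volume.restrict (Ioo 0 ℓ)] transOp K v := by
  filter_upwards [ae_restrict_of_ae_restrict_of_subset
    (Ioo_subset_Ioo_left (neg_nonpos.2 hℓ)) huv, ae_restrict_mem measurableSet_Ioo] with x hx hxℓ
  have neg_le_self : -x ≤ x := by linarith [hxℓ.1]
  rw [transOp, transOp, hx, ← setIntegral_Ioo_eq neg_le_self, ← setIntegral_Ioo_eq neg_le_self]
  congr 1
  refine integral_congr_ae ?_
  filter_upwards [ae_restrict_of_ae_restrict_of_subset
    (Ioo_subset_Ioo (neg_le_neg hxℓ.2.le) hxℓ.2.le) huv] with t ht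
  rw [ht]

end TransOp

section TriangleKernel

variable {ℓ x : ℝ} {K : ℝ → ℝ → ℂ} {g u : ℝ → ℂ}

/-- A kernel which is square integrable on the triangle and on each of its sections, as required
of transmutation kernels. -/
structure IsTriangleKernel (ℓ : ℝ) (K : ℝ → ℝ → ℂ) : Prop where
  memLp : MemLp (Function.uncurry K) 2 (volume.restrict (triangle ℓ))
  memLp_section : ∀ x ∈ Ioo 0 ℓ, MemL2 (-x) x (K x)

theorem IsTransmutationKernel.isTriangleKernel {q : (ℝ → ℂ) → ℂ} {f : ℝ → ℂ}
    (hK : IsTransmutationKernel ℓ q f K) : IsTriangleKernel ℓ K :=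
  ⟨hK.memLp, hK.memLp_section⟩

theorem integral_indicator_triangle {E : Type*} [NormedAddCommGroup E] [NormedSpace ℝ E]
    (F : ℝ × ℝ → E) (hx : x ∈ Ioo 0 ℓ) :
    ∫ t, (triangle ℓ).indicator F (x, t) = ∫ t in (-x)..x, F (x, t) := by
  have indicator_eq (t : ℝ) : (triangle ℓ).indicator F (x, t)
      = (Icc (-x) x).indicator (fun t => F (x, t)) t := by
    simp only [indicator, triangle, mem_ofPred_eq, hx.1.le, hx.2.le, true_and, abs_le, mem_Icc]
  simp only [indicator_eq]
  rw [integral_indicator measurableSet_Icc, integral_Icc_eq_integral_Ioo,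
    setIntegral_Ioo_eq (by linarith [hx.1])]

namespace IsTriangleKernel

theorem memLp_normL2_section (hK : IsTriangleKernel ℓ K) :
    MemLp (fun s => normL2 (-s) s (K s)) 2 (volume.restrict (Ioo 0 ℓ)) := by
  have integrable_indicator : Integrable
      ((triangle ℓ).indicator fun z => ‖Function.uncurry K z‖ ^ 2) (volume.prod volume) :=
    (integrable_indicator_iff (measurableSet_triangle ℓ)).2
      ((memLp_two_iff_integrable_sq_norm hK.memLp.1).1 hK.memLp)
  have integrableOn_sq : IntegrableOn (fun s => ∫ t in Ioo (-s) s, ‖K s t‖ ^ 2) (Ioo 0 ℓ) := by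
    refine integrable_indicator.integral_prod_left.integrableOn.congr ?_
    filter_upwards [ae_restrict_mem measurableSet_Ioo] with s hs
    rw [integral_indicator_triangle _ hs, setIntegral_Ioo_eq (by linarith [hs.1])]
    rfl
  refine (memLp_two_iff_integrable_sq
    (Real.continuous_sqrt.comp_aestronglyMeasurable integrableOn_sq.1)).2 ?_
  exact integrableOn_sq.congr (.of_forall fun s =>
    (Real.sq_sqrt (integral_nonneg fun t => by positivity)).symm)

theorem norm_integral_section_le (hK : IsTriangleKernel ℓ K) (hx : x ∈ Ioo 0 ℓ)
    (hu : MemL2 (-ℓ) ℓ u) :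
    ‖∫ t in (-x)..x, K x t * u t‖ ≤ normL2 (-x) x (K x) * normL2 (-ℓ) ℓ u :=
  (hK.memLp_section x hx).norm_intervalIntegral_mul_le hu (neg_le_neg hx.2.le)
    (by linarith [hx.1]) hx.2.le

theorem isL2Functional_integral_section (hK : IsTriangleKernel ℓ K) (hx : x ∈ Ioo 0 ℓ) :
    IsL2Functional (-ℓ) ℓ fun u => ∫ t in (-x)..x, K x t * u t :=
  (hK.memLp_section x hx).isL2Functional_integral_mul (neg_le_neg hx.2.le) (by linarith [hx.1])
    hx.2.le

theorem memL2_integral_section (hK : IsTriangleKernel ℓ K) (hu : MemL2 (-ℓ) ℓ u) :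
    MemL2 0 ℓ fun s => ∫ t in (-s)..s, K s t * u t := by
  refine MemLp.of_le_mul (c := normL2 (-ℓ) ℓ u) hK.memLp_normL2_section ?_ ?_
  · have measurable_mul : AEStronglyMeasurable
        ((triangle ℓ).indicator fun z => K z.1 z.2 * (Ioo (-ℓ) ℓ).indicator u z.2)
        (volume.prod volume) := by
      refine (aestronglyMeasurable_indicator_iff (measurableSet_triangle ℓ)).2 (hK.memLp.1.mul ?_)
      exact (((aestronglyMeasurable_indicator_iff measurableSet_Ioo).2 hu.1).comp_snd
        (μ := volume)).restrict
    refine measurable_mul.integral_prod_right'.restrict.congr ?_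
    filter_upwards [ae_restrict_mem measurableSet_Ioo] with s hs
    rw [integral_indicator_triangle _ hs]
    refine intervalIntegral.integral_congr_Ioo_of_le (by linarith [hs.1]) fun t ht => ?_
    rw [indicator_of_mem (Ioo_subset_Ioo (neg_le_neg hs.2.le) hs.2.le ht)]
  · filter_upwards [ae_restrict_mem measurableSet_Ioo] with s hs
    rw [Real.norm_of_nonneg (normL2_nonneg _ _ _), mul_comm]
    exact hK.norm_integral_section_le hs hu

theorem memL2_transOp (hK : IsTriangleKernel ℓ K) (hℓ : 0 ≤ ℓ) (hu : MemL2 (-ℓ) ℓ u) :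
    MemL2 0 ℓ (transOp K u) :=
  (hu.mono (neg_nonpos.2 hℓ) le_rfl).add (hK.memL2_integral_section hu)

theorem isL2Functional_transOp_integral (hK : IsTriangleKernel ℓ K) (hx : x ∈ Ioo 0 ℓ) :
    IsL2Functional (-ℓ) ℓ fun u => transOp K (fun t => ∫ s in (-ℓ)..t, u s) x :=
  (isL2Functional_integral le_rfl (by linarith [hx.1, hx.2]) hx.2.le).add
    ((hK.memLp_section x hx).isL2Functional_integral_mul_integral (neg_le_neg hx.2.le)
      (by linarith [hx.1]) hx.2.le)

theorem isL2Functional_integral_mul_integral_section (hK : IsTriangleKernel ℓ K)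
    (hx : x ∈ Ioo 0 ℓ) (hg : MemL2 0 x g) :
    IsL2Functional (-ℓ) ℓ fun u => ∫ s in 0..x, g s * ∫ t in (-s)..s, K s t * u t := by
  have mem_Ioo : ∀ᵐ s ∂volume.restrict (Ioo 0 x), s ∈ Ioo 0 ℓ :=
    (ae_restrict_mem measurableSet_Ioo).mono fun _ hs => ⟨hs.1, hs.2.trans hx.2⟩
  have restrict_le : volume.restrict (Ioo 0 x) ≤ volume.restrict (Ioo 0 ℓ) :=
    Measure.restrict_mono (Ioo_subset_Ioo_right hx.2.le) le_rfl
  simp only [← setIntegral_Ioo_eq hx.1.le]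
  refine .integral (C := fun s => ‖g s‖ * normL2 (-s) s (K s)) ?_
    ((MemLp.norm hg).integrable_mul (hK.memLp_normL2_section.mono_measure restrict_le)) ?_
    fun u hu => hg.1.mul ((hK.memL2_integral_section hu).1.mono_measure restrict_le)
  · filter_upwards [mem_Ioo] with s hs
    exact (hK.isL2Functional_integral_section hs).const_mul _
  · filter_upwards [mem_Ioo] with s hs u hu
    rw [norm_mul, mul_assoc]
    exact mul_le_mul_of_nonneg_left (hK.norm_integral_section_le hs hu) (norm_nonneg _)

theorem isL2Functional_integral_mul_transOp (hK : IsTriangleKernel ℓ K) (hx : x ∈ Ioo 0 ℓ)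
    (hg : MemL2 0 x g) :
    IsL2Functional (-ℓ) ℓ fun u => ∫ s in 0..x, g s * transOp K u s := by
  have hℓ : 0 < ℓ := hx.1.trans hx.2
  refine ((hg.isL2Functional_integral_mul (by linarith) hx.1.le hx.2.le).add
    (hK.isL2Functional_integral_mul_integral_section hx hg)).congr fun u hu => ?_
  have intervalIntegrable_mul {w : ℝ → ℂ} (hw : MemL2 0 ℓ w) :
      IntervalIntegrable (fun s => g s * w s) volume 0 x :=
    (intervalIntegrable_iff_integrableOn_Ioo_of_le hx.1.le).2
      (hg.integrableOn_mul (hw.mono le_rfl hx.2.le))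
  simp only [transOp, mul_add]
  exact intervalIntegral.integral_add (intervalIntegrable_mul (hu.mono (by linarith) le_rfl))
    (intervalIntegrable_mul (hK.memL2_integral_section hu))

end IsTriangleKernel

end TriangleKernel

/-! ### The transmutation property -/

section Transmutation

variable {ℓ x : ℝ} {c : ℂ} {f p g u y : ℝ → ℂ} {q q₁ : (ℝ → ℂ) → ℂ} {K K₁ : ℝ → ℝ → ℂ}

/-- The kernels `K` and `K₁` of the transmutation operators `T_f` and `T_{1/f}`, with `p = f'/f` and
the Riccati potentials `q = p² + p'` and `q₁ = p² - p'` of `f` and `1/f`. -/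
structure IsDarbouxPair (ℓ : ℝ) (f p : ℝ → ℂ) (q q₁ : (ℝ → ℂ) → ℂ) (K K₁ : ℝ → ℝ → ℂ) : Prop where
  pos : 0 < ℓ
  hasLogDeriv : HasLogDeriv 0 ℓ f p
  apply_zero : f 0 = 1
  isRiccatiPotential_fst : IsRiccatiPotential 0 ℓ q p
  isRiccatiPotential_snd : IsRiccatiPotential 0 ℓ q₁ (-p)
  isTransmutationKernel_fst : IsTransmutationKernel ℓ q f K
  isTransmutationKernel_snd : IsTransmutationKernel ℓ q₁ f⁻¹ K₁

namespace IsDarbouxPair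

theorem symm (h : IsDarbouxPair ℓ f p q q₁ K K₁) : IsDarbouxPair ℓ f⁻¹ (-p) q₁ q K₁ K where
  pos := h.pos
  hasLogDeriv := h.hasLogDeriv.inv
  apply_zero := by simp [h.apply_zero]
  isRiccatiPotential_fst := h.isRiccatiPotential_snd
  isRiccatiPotential_snd := (neg_neg p).symm ▸ h.isRiccatiPotential_fst
  isTransmutationKernel_fst := h.isTransmutationKernel_snd
  isTransmutationKernel_snd := (inv_inv f).symm ▸ h.isTransmutationKernel_fst

theorem neg_lt_self (h : IsDarbouxPair ℓ f p q q₁ K K₁) : -ℓ < ℓ :=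
  _root_.neg_lt_self h.pos

theorem isTriangleKernel_fst (h : IsDarbouxPair ℓ f p q q₁ K K₁) : IsTriangleKernel ℓ K :=
  h.isTransmutationKernel_fst.isTriangleKernel

theorem isTriangleKernel_snd (h : IsDarbouxPair ℓ f p q q₁ K K₁) : IsTriangleKernel ℓ K₁ :=
  h.isTransmutationKernel_snd.isTriangleKernel

theorem transOp_exp (h : IsDarbouxPair ℓ f p q q₁ K K₁) (c : ℂ) (hx : x ∈ Ioo 0 ℓ) :
    transOp K (fun t : ℝ => Complex.exp (c * t)) x
      = f x * (1 + c * ∫ s in 0..x, (f s)⁻¹ * transOp K₁ (fun t : ℝ => Complex.exp (c * t)) s) := by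
  have I_mul_exponent : Complex.I * (-(Complex.I * c)) = c := by
    linear_combination -c * Complex.I_sq
  obtain ⟨e, he, he_eq⟩ := h.isTransmutationKernel_fst.representation (-(Complex.I * c))
  obtain ⟨e₁, he₁, he₁_eq⟩ := h.isTransmutationKernel_snd.representation (-(Complex.I * c))
  simp only [I_mul_exponent] at he_eq he₁_eq
  have mem_Icc := Ioo_subset_Icc_self hx
  have quotient := (he.isPrimitive_div h.pos h.hasLogDeriv h.apply_zero
    h.isRiccatiPotential_fst h.isRiccatiPotential_snd he₁).eq_add_integral x mem_Icc
  rw [he.init, h.apply_zero, div_one, div_eq_iff (h.hasLogDeriv.ne_zero x mem_Icc),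
    I_mul_exponent] at quotient
  rw [← he_eq x hx, quotient, mul_comm, ← intervalIntegral.integral_const_mul]
  congr 2
  refine intervalIntegral.integral_congr_Ioo_of_le hx.1.le fun s hs => ?_
  rw [← he₁_eq s ⟨hs.1, hs.2.trans hx.2⟩]
  ring

theorem transOp_one (h : IsDarbouxPair ℓ f p q q₁ K K₁) (hx : x ∈ Ioo 0 ℓ) :
    transOp K (fun _ => 1) x = f x := by
  simpa using h.transOp_exp 0 hx

theorem transOp_const_add (h : IsDarbouxPair ℓ f p q q₁ K K₁) (hx : x ∈ Ioo 0 ℓ) (c : ℂ)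
    (hg : MemL2 (-x) x g) :
    transOp K (fun t => c + g t) x = c * f x + transOp K g x := by
  have transOp_const := transOp_const_mul K c (fun _ => 1) x
  simp only [mul_one] at transOp_const
  rw [transOp_add hx.1.le (h.isTriangleKernel_fst.memLp_section x hx)
    (memL2_of_continuousOn continuousOn_const) hg, transOp_const, h.transOp_one hx]

theorem transOp_integral_exp (h : IsDarbouxPair ℓ f p q q₁ K K₁) (hc : c ≠ 0)
    (hx : x ∈ Ioo 0 ℓ) :
    transOp K (fun t => ∫ s in (-ℓ)..t, Complex.exp (c * s)) x
      = f x * ((∫ s in (-ℓ)..0, Complex.exp (c * s))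
        + ∫ s in 0..x, (f s)⁻¹ * transOp K₁ (fun t : ℝ => Complex.exp (c * t)) s) := by
  have integral_exp (t : ℝ) : ∫ s in (-ℓ)..t, Complex.exp (c * s)
      = -(c⁻¹ * Complex.exp (c * (-ℓ : ℝ))) + c⁻¹ * Complex.exp (c * t) := by
    rw [integral_exp_mul_complex hc]
    ring
  simp only [integral_exp]
  rw [h.transOp_const_add hx _ (memL2_of_continuousOn (Continuous.continuousOn (by fun_prop))),
    transOp_const_mul, h.transOp_exp c hx, Complex.ofReal_zero, mul_zero, Complex.exp_zero]
  field_simp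
  ring

theorem transOp_integral (h : IsDarbouxPair ℓ f p q q₁ K K₁) (hx : x ∈ Ioo 0 ℓ)
    (hu : MemL2 (-ℓ) ℓ u) :
    transOp K (fun t => ∫ s in (-ℓ)..t, u s) x
      = f x * ((∫ s in (-ℓ)..0, u s) + ∫ s in 0..x, (f s)⁻¹ * transOp K₁ u s) := by
  have memL2_inv : MemL2 0 x f⁻¹ :=
    (memL2_of_continuousOn h.hasLogDeriv.inv.continuousOn).mono le_rfl hx.2.le
  have isL2Functional_rhs := ((isL2Functional_integral le_rfl (neg_nonpos.2 h.pos.le) h.pos.le).add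
    (h.isTriangleKernel_snd.isL2Functional_integral_mul_transOp hx memL2_inv)).const_mul (f x)
  have isL2Functional_sub := (h.isTriangleKernel_fst.isL2Functional_transOp_integral hx).add
    (isL2Functional_rhs.const_mul (-1))
  have eq_zero := isL2Functional_sub.eq_zero_of_exp (fun n => ?_) hu
  · exact sub_eq_zero.1 (by simpa only [neg_one_mul, ← sub_eq_add_neg, Pi.inv_apply] using eq_zero)
  · rw [h.transOp_integral_exp (Nat.cast_add_one_ne_zero n) hx]
    simp only [Pi.inv_apply]
    ring

theorem exists_isPrimitive_transOp (h : IsDarbouxPair ℓ f p q q₁ K K₁) (hy : MemW12 (-ℓ) ℓ y) :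
    ∃ V, IsPrimitive 0 ℓ V (fun x => (f x)⁻¹ * transOp K₁ (weakDeriv (-ℓ) ℓ y) x) ∧
      transOp K y =ᵐ[volume.restrict (Ioo 0 ℓ)] fun x => f x * V x := by
  obtain ⟨v, hv⟩ := hy.exists_hasACRepr h.neg_lt_self
  have memL2_transOp := h.isTriangleKernel_snd.memL2_transOp h.pos.le hv.memL2_deriv
  have memL2_integrand := memL2_transOp.continuousOn_mul h.hasLogDeriv.inv.continuousOn
  refine ⟨_, .const_add_integral h.pos.le (memL2_integrand.intervalIntegrable h.pos.le) (v 0), ?_⟩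
  have eq_integral := hv.isPrimitive.eq_add_integral
  have repr_ae_eq : y =ᵐ[volume.restrict (Ioo (-ℓ) ℓ)]
      fun t => v (-ℓ) + ∫ s in (-ℓ)..t, weakDeriv (-ℓ) ℓ y s := by
    filter_upwards [hv.ae_eq, ae_restrict_mem measurableSet_Ioo] with t hyt ht
    rw [hyt, eq_integral t (Ioo_subset_Icc_self ht)]
  filter_upwards [transOp_congr_ae h.pos.le repr_ae_eq, ae_restrict_mem measurableSet_Ioo]
    with x hyx hx
  have memL2_integral : MemL2 (-x) x fun t => ∫ s in (-ℓ)..t, weakDeriv (-ℓ) ℓ y s :=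
    (memL2_of_continuousOn (hv.memL2_deriv.isPrimitive_integral h.neg_lt_self.le).continuousOn).mono
      (neg_le_neg hx.2.le) hx.2.le
  rw [hyx, h.transOp_const_add hx _ memL2_integral, h.transOp_integral hx hv.memL2_deriv,
    eq_integral 0 ⟨neg_nonpos.2 h.pos.le, h.pos.le⟩]
  simp only [Pi.inv_apply]
  ring

theorem exists_hasACRepr_transOp (h : IsDarbouxPair ℓ f p q q₁ K K₁) (hy : MemW12 (-ℓ) ℓ y) :
    ∃ z, HasACRepr 0 ℓ (transOp K y) z
      (fun x => p x * z x + transOp K₁ (weakDeriv (-ℓ) ℓ y) x) := by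
  obtain ⟨V, hV, hyV⟩ := h.exists_isPrimitive_transOp hy
  obtain ⟨v, hv⟩ := hy.exists_hasACRepr h.neg_lt_self
  have hfV := h.hasLogDeriv.isPrimitive.mul hV
  refine ⟨fun x => f x * V x, hfV.congr (fun _ _ => rfl) ?_,
    (h.hasLogDeriv.memL2.mul_continuousOn hfV.continuousOn).add
      (h.isTriangleKernel_snd.memL2_transOp h.pos.le hv.memL2_deriv), hyV⟩
  filter_upwards [h.hasLogDeriv.ae_ne_zero] with x hfx
  field_simp

theorem memW12_transOp (h : IsDarbouxPair ℓ f p q q₁ K K₁) (hy : MemW12 (-ℓ) ℓ y) :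
    MemW12 0 ℓ (transOp K y) :=
  (h.exists_hasACRepr_transOp hy).choose_spec.memW12

theorem opD_transOp_ae_eq (h : IsDarbouxPair ℓ f p q q₁ K K₁) (hy : MemW12 (-ℓ) ℓ y) :
    opD 0 ℓ f (transOp K y) =ᵐ[volume.restrict (Ioo 0 ℓ)] transOp K₁ (weakDeriv (-ℓ) ℓ y) := by
  obtain ⟨z, hz⟩ := h.exists_hasACRepr_transOp hy
  simpa only [add_sub_cancel_left] using h.hasLogDeriv.opD_ae_eq hz

theorem schrodingerEq_transOp (h : IsDarbouxPair ℓ f p q q₁ K K₁) (hy : MemW22 (-ℓ) ℓ y) :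
    SchrodingerEq 0 ℓ q (transOp K y) (-transOp K (weakDeriv (-ℓ) ℓ (weakDeriv (-ℓ) ℓ y))) := by
  obtain ⟨z, hz⟩ := h.exists_hasACRepr_transOp hy.1
  -- `D_{1/f} T_{1/f} y' = T_f y''` is the first-order identity with `f` and `1/f` swapped.
  obtain ⟨B, hB, hyB⟩ := h.symm.exists_isPrimitive_transOp hy.2
  obtain ⟨_, hv⟩ := hy.2.exists_hasACRepr h.neg_lt_self
  have memL2_transOp := h.isTriangleKernel_fst.memL2_transOp h.pos.le hv.memL2_deriv
  refine h.isRiccatiPotential_fst.schrodingerEq h.pos h.hasLogDeriv hz memL2_transOp.neg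
    (hB.congr (fun _ _ => rfl) (.of_forall fun x => by simp)) ?_
  filter_upwards [hyB, h.hasLogDeriv.ae_ne_zero] with x hyx hfx
  rw [add_sub_cancel_left, hyx, Pi.inv_apply, mul_inv_cancel_left₀ hfx]

end IsDarbouxPair

end Transmutation

end DistSchrodinger

theorem mainTheorem3 (ℓ : ℝ) (hℓ : 0 < ℓ) (q : (ℝ → ℂ) → ℂ)
    (hq : DistSchrodinger.IsNegSobolev 0 ℓ q) (f : ℝ → ℂ)
    (hf : DistSchrodinger.IsNonvanishingSolution 0 ℓ q f) (hf0 : f 0 = 1) :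
    (∃ K, DistSchrodinger.IsTransmutationKernel ℓ q f K) ∧
    (∃ K', DistSchrodinger.IsTransmutationKernel ℓ
      (DistSchrodinger.darbouxPotential 0 ℓ f) f⁻¹ K') ∧
    ∀ K K' : ℝ → ℝ → ℂ, DistSchrodinger.IsTransmutationKernel ℓ q f K →
      DistSchrodinger.IsTransmutationKernel ℓ
        (DistSchrodinger.darbouxPotential 0 ℓ f) f⁻¹ K' →
      (∀ y : ℝ → ℂ, DistSchrodinger.MemW12 (-ℓ) ℓ y →
        DistSchrodinger.MemW12 0 ℓ (DistSchrodinger.transOp K y) ∧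
        DistSchrodinger.opD 0 ℓ f (DistSchrodinger.transOp K y)
          =ᵐ[MeasureTheory.volume.restrict (Set.Ioo 0 ℓ)]
            DistSchrodinger.transOp K' (DistSchrodinger.weakDeriv (-ℓ) ℓ y)) ∧
      (∀ y : ℝ → ℂ, DistSchrodinger.MemW22 (-ℓ) ℓ y →
        DistSchrodinger.transOp K y ∈ DistSchrodinger.regularizationDomain 0 ℓ q ∧
        DistSchrodinger.SchrodingerEq 0 ℓ q (DistSchrodinger.transOp K y)
          (-DistSchrodinger.transOp K
            (DistSchrodinger.weakDeriv (-ℓ) ℓ (DistSchrodinger.weakDeriv (-ℓ) ℓ y)))) := by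
  have hp := hf.hasLogDeriv hℓ
  have hq_riccati := hf.isRiccatiPotential hℓ hq
  have hq₁_riccati := hp.inv.isRiccatiPotential_potentialOf
  refine ⟨DistSchrodinger.exists_isTransmutationKernel hℓ hp hq_riccati,
    DistSchrodinger.exists_isTransmutationKernel hℓ hp.inv hq₁_riccati, fun K K' hK hK' => ?_⟩
  have pair : DistSchrodinger.IsDarbouxPair ℓ f _ q _ K K' :=
    ⟨hℓ, hp, hf0, hq_riccati, hq₁_riccati, hK, hK'⟩
  exact ⟨fun y hy => ⟨pair.memW12_transOp hy, pair.opD_transOp_ae_eq hy⟩,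
    fun y hy => ⟨⟨pair.memW12_transOp hy.1, _, pair.schrodingerEq_transOp hy⟩,
      pair.schrodingerEq_transOp hy⟩⟩
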